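/- Let $\lambda>0$ be real, let $N\ge 0$ be an integer, and write $e(z)=e^{2\pi i z}$. For complex $v,\tau$ with $\operatorname{Im}\tau>0$ put $$\theta_2(v,\tau)=\sum_{n\in\mathbb Z}(-1)^n e^{\pi i\tau n^2}e(nv),\qquad \theta_3(v,\tau)=\sum_{n\in\mathbb Z}e^{\pi i\tau n^2}e(nv).$$ For $\mu>0$ let $G_\mu(x)=e^{-\pi\mu x^2}$, and let $L_\mu$, $M_\mu$ be the entire functions $$L_\mu(z)=\Bigl(\frac{\cos\pi z}{\pi}\Bigr)^2\Bigl\{\sum_{m\in\mathbb Z}\frac{G_\mu(m+\frac12)}{(z-m-\frac12)^2}+\sum_{n\in\mathbb Z}\frac{G_\mu'(n+\frac12)}{z-n-\frac12}\Bigr\},\qquad M_\mu(z)=\Bigl(\frac{\sin\pi z}{\pi}\Bigr)^2\Bigl\{\sum_{m\in\mathbb Z}\frac{G_\mu(m)}{(z-m)^2}+\sum_{n\in\mathbb Z}\frac{G_\mu'(n)}{z-n}\Bigr\}$$ (with the removable singularities filled in). Define the functions $l_{\lambda,N}$ and $m_{\lambda,N}$ on $\mathbb R/\mathbb Z$ by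 $$l_{\lambda,N}(x)=\lambda^{1/2}\sum_{n\in\mathbb Z}L_{(N+1)^{-2}\lambda}\bigl((N+1)(x+n)\bigr),\qquad m_{\lambda,N}(x)=\lambda^{1/2}\sum_{n\in\mathbb Z}M_{(N+1)^{-2}\lambda}\bigl((N+1)(x+n)\bigr).$$ A real valued trigonometric polynomial of degree at most $N$ is a real valued function on $\mathbb R/\mathbb Z$ of the form $x\mapsto\sum_{n=-N}^{N}c_n e(nx)$ with complex coefficients $c_n$. The functions $l_{\lambda,N}$ and $m_{\lambda,N}$ are real valued trigonometric polynomials of degree at most $N$, and $l_{\lambda,N}(x)\le\theta_3(x,i\lambda^{-1})\le m_{\lambda,N}(x)$ for all $x\in\mathbb R/\mathbb Z$. Moreover: (1) If $q$ is a real valued trigonometric polynomial of degree at most $N$ with $q(x)\le\theta_3(x,i\lambda^{-1})$ for all $x\in\mathbb R/\mathbb Z$, then $$\int_{\mathbb R/\mathbb Z}q(x)\,dx\le\theta_2\bigl(0,i\lambda^{-1}(N+1)^2\bigr),$$ with equality if and only if $q=l_{\lambda,N}$. (2) If $r$ is a real valued trigonometric polynomial of degree at most $N$ with $\theta_3(x,i\lambda^{-1})\le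 r(x)$ for all $x\in\mathbb R/\mathbb Z$, then $$\theta_3\bigl(0,i\lambda^{-1}(N+1)^2\bigr)\le\int_{\mathbb R/\mathbb Z}r(x)\,dx,$$ with equality if and only if $r=m_{\lambda,N}$. -/

import Mathlib

open scoped Real

noncomputable section

/-- The theta function `θ₂(v, τ) = ∑ₙ (-1)ⁿ q^{n²} e(nv)`, where `q = e^{πiτ}` and `e(z) = e^{2πiz}`. -/
def theta2 (v τ : ℂ) : ℂ :=
  ∑' n : ℤ, (-1 : ℂ) ^ n *
    (Complex.exp (π * Complex.I * τ) ^ (n ^ 2) * Complex.exp (2 * π * Complex.I * (n * v)))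

/-- The theta function `θ₃(v, τ) = ∑ₙ q^{n²} e(nv)`, where `q = e^{πiτ}` and `e(z) = e^{2πiz}`. -/
def theta3 (v τ : ℂ) : ℂ :=
  ∑' n : ℤ,
    Complex.exp (π * Complex.I * τ) ^ (n ^ 2) * Complex.exp (2 * π * Complex.I * (n * v))

/-- `θ₃` is Mathlib's two-variable Jacobi theta function. -/
theorem theta3_eq_jacobiTheta₂ (v τ : ℂ) : theta3 v τ = jacobiTheta₂ v τ := by
  unfold theta3 jacobiTheta₂ jacobiTheta₂_term
  refine tsum_congr fun n => ?_
  rw [← Complex.exp_int_mul, ← Complex.exp_add]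
  congr 1
  push_cast
  ring

/-- The Gaussian `G_λ(x) = e^{-πλx²}`. -/
def gaussianFn (lam x : ℝ) : ℝ := Real.exp (-π * lam * x ^ 2)

/-- The restriction to the real line of the entire function `L_λ`, that is of
`(cos πz / π)² { ∑ₘ G_λ(m+½)/(z-m-½)² + ∑ₙ G_λ'(n+½)/(z-n-½) }`,
with the removable singularities at `z ∈ ℤ + ½` filled in: each factor
`(cos πx / π)² / (x-n-½)²` is written as `sinc² (π(x-n-½))`. -/
def gaussianL (lam x : ℝ) : ℝ :=
  (∑' m : ℤ, gaussianFn lam (m + 1 / 2) * Real.sinc (π * (x - m - 1 / 2)) ^ 2) +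
    ∑' n : ℤ, deriv (gaussianFn lam) (n + 1 / 2) *
      ((x - n - 1 / 2) * Real.sinc (π * (x - n - 1 / 2)) ^ 2)

/-- The restriction to the real line of the entire function `M_λ`, that is of
`(sin πz / π)² { ∑ₘ G_λ(m)/(z-m)² + ∑ₙ G_λ'(n)/(z-n) }`,
with the removable singularities at `z ∈ ℤ` filled in: each factor
`(sin πx / π)² / (x-n)²` is written as `sinc² (π(x-n))`. -/
def gaussianM (lam x : ℝ) : ℝ :=
  (∑' m : ℤ, gaussianFn lam m * Real.sinc (π * (x - m)) ^ 2) +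
    ∑' n : ℤ, deriv (gaussianFn lam) n * ((x - n) * Real.sinc (π * (x - n)) ^ 2)

/-- Off the half-integers, `gaussianL` is given by the interpolation formula. -/
theorem gaussianL_of_ne (lam x : ℝ) (hx : ∀ n : ℤ, x - n - 1 / 2 ≠ 0) :
    gaussianL lam x = (Real.cos (π * x) / π) ^ 2 *
      ((∑' m : ℤ, gaussianFn lam (m + 1 / 2) / (x - m - 1 / 2) ^ 2) +
        ∑' n : ℤ, deriv (gaussianFn lam) (n + 1 / 2) / (x - n - 1 / 2)) := by
  have key : ∀ n : ℤ, Real.sinc (π * (x - n - 1 / 2)) ^ 2 =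
      (Real.cos (π * x) / π) ^ 2 / (x - n - 1 / 2) ^ 2 := by
    intro n
    have h := hx n
    have h2 : Real.sin (π * (x - n - 1 / 2)) ^ 2 = Real.cos (π * x) ^ 2 := by
      have e : π * (x - n - 1 / 2) = (π * x - π / 2) - n * π := by ring
      rw [e, Real.sin_sub_int_mul_pi, Real.sin_sub_pi_div_two, mul_pow, ← zpow_natCast,
        ← zpow_mul, mul_comm n, zpow_mul]
      norm_num
    rw [Real.sinc_of_ne_zero (mul_ne_zero Real.pi_ne_zero h), div_pow, h2, mul_pow, div_pow,
      div_div]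
  rw [mul_add, ← tsum_mul_left, ← tsum_mul_left, gaussianL]
  congr 1 <;> refine tsum_congr fun n => ?_
  · rw [key]; ring
  · rw [key]
    have h := hx n
    field_simp

/-- Off the integers, `gaussianM` is given by the interpolation formula. -/
theorem gaussianM_of_ne (lam x : ℝ) (hx : ∀ n : ℤ, x - n ≠ 0) :
    gaussianM lam x = (Real.sin (π * x) / π) ^ 2 *
      ((∑' m : ℤ, gaussianFn lam m / (x - m) ^ 2) +
        ∑' n : ℤ, deriv (gaussianFn lam) n / (x - n)) := by
  have key : ∀ n : ℤ, Real.sinc (π * (x - n)) ^ 2 =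
      (Real.sin (π * x) / π) ^ 2 / (x - n) ^ 2 := by
    intro n
    have h := hx n
    have h2 : Real.sin (π * (x - n)) ^ 2 = Real.sin (π * x) ^ 2 := by
      have e : π * (x - n) = π * x - n * π := by ring
      rw [e, Real.sin_sub_int_mul_pi, mul_pow, ← zpow_natCast,
        ← zpow_mul, mul_comm n, zpow_mul]
      norm_num
    rw [Real.sinc_of_ne_zero (mul_ne_zero Real.pi_ne_zero h), div_pow, h2, mul_pow, div_pow,
      div_div]
  rw [mul_add, ← tsum_mul_left, ← tsum_mul_left, gaussianM]
  congr 1 <;> refine tsum_congr fun n => ?_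
  · rw [key]; ring
  · rw [key]
    have h := hx n
    field_simp

/-- A periodization over `ℤ`, scaled by `δ`, has period `1`. -/
theorem periodic_tsum_int (c δ : ℝ) (F : ℝ → ℝ) :
    Function.Periodic (fun x : ℝ => c * ∑' n : ℤ, F (δ * (x + n))) 1 := by
  intro x
  simp only
  congr 1
  rw [← (Equiv.addRight (1 : ℤ)).tsum_eq (fun n : ℤ => F (δ * (x + n)))]
  refine tsum_congr fun n => ?_
  simp only [Equiv.coe_addRight]
  push_cast
  congr 2
  ring

/-- `l_{λ,N}(x) = λ^{1/2} ∑ₙ L_{(N+1)⁻²λ}((N+1)(x+n))` on `ℝ/ℤ`. -/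
def thetaMinorant (lam : ℝ) (N : ℕ) : UnitAddCircle → ℝ :=
  (periodic_tsum_int (√lam) (N + 1) (gaussianL (((N : ℝ) + 1) ^ (-2 : ℤ) * lam))).lift

/-- `m_{λ,N}(x) = λ^{1/2} ∑ₙ M_{(N+1)⁻²λ}((N+1)(x+n))` on `ℝ/ℤ`. -/
def thetaMajorant (lam : ℝ) (N : ℕ) : UnitAddCircle → ℝ :=
  (periodic_tsum_int (√lam) (N + 1) (gaussianM (((N : ℝ) + 1) ^ (-2 : ℤ) * lam))).lift

/-- `q` is a real valued trigonometric polynomial on `ℝ/ℤ` of degree at most `N`, that is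
`q(x) = ∑_{|n| ≤ N} cₙ e(nx)` with complex coefficients `cₙ`. -/
def IsRealTrigPoly (N : ℕ) (q : UnitAddCircle → ℝ) : Prop :=
  ∃ c : ℤ → ℂ, ∀ x : UnitAddCircle,
    (q x : ℂ) = ∑ n ∈ Finset.Icc (-(N : ℤ)) N, c n * fourier n x

/-- `θ₃(x, it)` is real for real `x` and `t`. -/
theorem theta3_im_eq_zero (x t : ℝ) : (theta3 x (Complex.I * t)).im = 0 := by
  rw [theta3_eq_jacobiTheta₂]
  apply Complex.conj_eq_iff_im.mp
  rw [jacobiTheta₂_conj]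
  simp

/-- The real number `θ₃(x, it)` for real `x` and `t`. -/
theorem theta3_eq_ofReal (x t : ℝ) :
    theta3 x (Complex.I * t) = ((theta3 x (Complex.I * t)).re : ℂ) := by
  apply Complex.ext <;> simp [theta3_im_eq_zero]

/-- `θ₂(0, it)` is real for real `t`. -/
theorem theta2_im_eq_zero (t : ℝ) : (theta2 0 (Complex.I * t)).im = 0 := by
  have h : theta2 0 (Complex.I * t) = theta3 ((1 / 2 : ℝ) : ℂ) (Complex.I * t) := by
    unfold theta2 theta3
    refine tsum_congr fun n => ?_
    have e : Complex.exp (2 * π * Complex.I * (n * ((1 / 2 : ℝ) : ℂ))) = (-1 : ℂ) ^ n := by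
      rw [← Complex.exp_pi_mul_I, ← Complex.exp_int_mul]
      congr 1
      push_cast
      ring
    rw [e]
    simp [mul_comm]
  rw [h, theta3_im_eq_zero]

end

noncomputable section

/-! The one-sided inequalities come from the Jacobi product. Normalised by positive constants, the
finite products `∏ (1 + 2 rᵢ cos 2πx + rᵢ²)` with `rᵢ = q^(2i+1)` converge to the theta function
(`exists_thetaProd_eq`, `tendsto_thetaApproxCoeff`). Take `ε = 1` for majorants and `ε = -1` for
minorants. By induction on the number of factors, such a product equals `U - ε (2 - 2ε cos 2π(N+1)x)
S`, with `U` a cosine polynomial of degree at most `N` and `S ≥ 0` (`Decomposes.step`). Multiplying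
`U` by one more factor produces a single term of frequency `N+1`. That term is traded for a
constant, kept in `U`, and a multiple of `2 - 2ε cos 2π(N+1)x`, absorbed in `S`.

Hence `U` lies on the correct side of the product and touches it at the nodes `(j+a)/(N+1)`, where
`cos 2πa = ε`. Touching forces equal derivatives, so `U` is the Hermite interpolant of the product.
Interpolation involves only finitely many values and derivatives, so both properties survive the
limit (`hermiteInterp_theta`).

The interpolant of theta is the periodization in the statement. Periodizing `sinc²` gives the Fejér
kernel, periodizing `y sinc²` gives a conjugate kernel (`hasSum_interpolation_series`), and Poisson
summation turns Gaussian data into theta data.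

For extremality, a polynomial of degree at most `N` has integral equal to its mean over the `N+1`
nodes (`IsRealTrigPoly.integral_eq`), and the mean of theta over the nodes is the claimed bound
(`sum_theta_interpNode`). Equality in the bound forces contact at every node, so the polynomial is
again the Hermite interpolant. -/

/-! ### One-sided approximation of finite Jacobi products by cosine polynomials. -/

theorem sum_Icc_neg_succ {M : Type*} [AddCommMonoid M] (N : ℕ) (g : ℤ → M) :
    ∑ n ∈ Finset.Icc (-((N + 1 : ℕ) : ℤ)) (N + 1 : ℕ), g n =
      ∑ n ∈ Finset.Icc (-(N : ℤ)) N, g n + (g (N + 1) + g (-(N + 1))) := by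
  have h : Finset.Icc (-((N + 1 : ℕ) : ℤ)) (N + 1 : ℕ) =
      insert ((N : ℤ) + 1) (insert (-((N : ℤ) + 1)) (Finset.Icc (-(N : ℤ)) N)) := by
    ext n
    simp only [Finset.mem_Icc, Finset.mem_insert]
    push_cast
    omega
  rw [h, Finset.sum_insert, Finset.sum_insert]
  · rw [← add_assoc, add_comm]
  · simp
  · simp only [Finset.mem_Icc, Finset.mem_insert]
    omega

theorem sum_Icc_neg_shift {M : Type*} [AddCommGroup M] (N : ℕ) (g : ℤ → M) :
    ∑ n ∈ Finset.Icc (-(N : ℤ)) N, g (n + 1) =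
      ∑ n ∈ Finset.Icc (-(N : ℤ)) N, g n + g (N + 1) - g (-N) := by
  induction N with
  | zero => simp
  | succ N ih =>
    rw [sum_Icc_neg_succ, sum_Icc_neg_succ, ih]
    push_cast
    rw [show -((N : ℤ) + 1) + 1 = -N by ring]
    abel

/-- The even trigonometric polynomial with coefficients `u n`, `|n| ≤ N`. -/
def cosPoly (N : ℕ) (u : ℤ → ℝ) (x : ℝ) : ℝ :=
  ∑ n ∈ Finset.Icc (-(N : ℤ)) N, u n * Real.cos (2 * π * n * x)

/-- The product formula for cosines shifts indices by one in each direction. Only the two ends leave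
the window, and by evenness they merge into one term of frequency `N+1`. -/
theorem cosPoly_mul (N : ℕ) (u : ℤ → ℝ) (heven : ∀ n, u (-n) = u n) (hsupp : u (N + 1) = 0)
    (r x : ℝ) :
    (1 + 2 * r * Real.cos (2 * π * x) + r ^ 2) * cosPoly N u x =
      cosPoly N (fun n => (1 + r ^ 2) * u n + r * (u (n - 1) + u (n + 1))) x +
        2 * r * u N * Real.cos (2 * π * (N + 1) * x) := by
  have e1 : u (-(N : ℤ) - 1) = 0 := by
    rw [← hsupp, ← heven]; congr 1; ring
  have h1 : ∑ n ∈ Finset.Icc (-(N : ℤ)) N, u n * Real.cos (2 * π * (n + 1) * x) =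
      ∑ n ∈ Finset.Icc (-(N : ℤ)) N, u (n - 1) * Real.cos (2 * π * n * x) +
        u N * Real.cos (2 * π * (N + 1) * x) := by
    have := sum_Icc_neg_shift N (fun n => u (n - 1) * Real.cos (2 * π * n * x))
    simpa [e1] using this
  have h2 : ∑ n ∈ Finset.Icc (-(N : ℤ)) N, u (n + 1) * Real.cos (2 * π * n * x) =
      ∑ n ∈ Finset.Icc (-(N : ℤ)) N, u n * Real.cos (2 * π * (n - 1) * x) -
        u N * Real.cos (2 * π * (N + 1) * x) := by
    have h4 : Real.cos (2 * π * (-(N : ℝ) - 1) * x) = Real.cos (2 * π * (N + 1) * x) := by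
      rw [← Real.cos_neg]; congr 1; ring
    have := sum_Icc_neg_shift N (fun n => u n * Real.cos (2 * π * (n - 1) * x))
    simpa [hsupp, heven, h4] using this
  have e3 : ∀ n : ℤ, (1 + 2 * r * Real.cos (2 * π * x) + r ^ 2) *
      (u n * Real.cos (2 * π * n * x)) = (1 + r ^ 2) * (u n * Real.cos (2 * π * n * x)) +
      (r * (u n * Real.cos (2 * π * (n + 1) * x)) + r * (u n * Real.cos (2 * π * (n - 1) * x))) := by
    intro n
    rw [show 2 * π * (n + 1) * x = 2 * π * n * x + 2 * π * x by ring,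
      show 2 * π * (n - 1) * x = 2 * π * n * x - 2 * π * x by ring, Real.cos_add, Real.cos_sub]
    ring
  have e4 : ∀ n : ℤ, ((1 + r ^ 2) * u n + r * (u (n - 1) + u (n + 1))) *
      Real.cos (2 * π * n * x) = (1 + r ^ 2) * (u n * Real.cos (2 * π * n * x)) +
      (r * (u (n - 1) * Real.cos (2 * π * n * x)) + r * (u (n + 1) * Real.cos (2 * π * n * x))) :=
    fun n => by ring
  simp only [cosPoly, Finset.mul_sum, e3, e4, Finset.sum_add_distrib]
  simp only [← Finset.mul_sum]
  linear_combination r * h1 - r * h2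

/-- One step of the recursion for the coefficients of the interpolating polynomial. -/
def stepCoeff (N : ℕ) (ε r : ℝ) (u : ℤ → ℝ) (n : ℤ) : ℝ :=
  if |n| ≤ N then (1 + r ^ 2) * u n + r * (u (n - 1) + u (n + 1)) +
    (if n = 0 then 2 * ε * r * u N else 0) else 0

theorem cosPoly_stepCoeff (N : ℕ) (ε r : ℝ) (u : ℤ → ℝ) (x : ℝ) :
    cosPoly N (stepCoeff N ε r u) x =
      cosPoly N (fun n => (1 + r ^ 2) * u n + r * (u (n - 1) + u (n + 1))) x +
        2 * ε * r * u N := by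
  have h : ∀ n ∈ Finset.Icc (-(N : ℤ)) N, stepCoeff N ε r u n * Real.cos (2 * π * n * x) =
      ((1 + r ^ 2) * u n + r * (u (n - 1) + u (n + 1))) * Real.cos (2 * π * n * x) +
        (if n = 0 then 2 * ε * r * u N else 0) := by
    intro n hn
    rw [Finset.mem_Icc] at hn
    rw [stepCoeff, if_pos (abs_le.mpr hn)]
    by_cases h0 : n = 0
    · simp [h0]
    · simp [h0]
  rw [cosPoly, Finset.sum_congr rfl h, Finset.sum_add_distrib, cosPoly]
  simp

theorem stepCoeff_even (N : ℕ) (ε r : ℝ) (u : ℤ → ℝ) (heven : ∀ n, u (-n) = u n) (n : ℤ) :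
    stepCoeff N ε r u (-n) = stepCoeff N ε r u n := by
  have h1 : u (-n - 1) = u (n + 1) := by rw [← heven]; congr 1; ring
  have h2 : u (-n + 1) = u (n - 1) := by rw [← heven]; congr 1; ring
  simp [stepCoeff, heven, h1, h2, add_comm (u (n + 1))]

theorem one_add_two_mul_cos_nonneg (r x : ℝ) : 0 ≤ 1 + 2 * r * Real.cos x + r ^ 2 := by
  nlinarith [sq_nonneg (r + Real.cos x), Real.sin_sq_add_cos_sq x, sq_nonneg (Real.sin x)]

/-- `f` is a nonnegative-coefficient cosine polynomial of degree `N`, up to a nonnegative multiple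
of `2 - 2 ε cos (2π(N+1)x)`. -/
def Decomposes (N : ℕ) (ε : ℝ) (f : ℝ → ℝ) (u : ℤ → ℝ) (S : ℝ → ℝ) : Prop :=
  (∀ n, u (-n) = u n) ∧ (∀ n : ℤ, (N : ℤ) < |n| → u n = 0) ∧ (∀ n, 0 ≤ u n) ∧ (∀ x, 0 ≤ S x) ∧
    ∀ x, f x = cosPoly N u x - ε * (2 - 2 * ε * Real.cos (2 * π * (N + 1) * x)) * S x

/-- Since `ε² = 1`, the overflow `2 r u_N cos` equals `2ε r u_N - ε (2 - 2ε cos) r u_N`. The first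
part is the correction to the zeroth coefficient and the second adds `r u_N` to `S`. Nonnegative
coefficients are carried along to keep `S` nonnegative. Only the zeroth one can fail, hence the last
hypothesis. -/
theorem Decomposes.step {N : ℕ} {ε : ℝ} {f : ℝ → ℝ} {u : ℤ → ℝ} {S : ℝ → ℝ}
    (h : Decomposes N ε f u S) (hε : ε ^ 2 = 1) {r : ℝ} (hr : 0 ≤ r)
    (h0 : 0 ≤ stepCoeff N ε r u 0) :
    Decomposes N ε (fun x => f x * (1 + 2 * r * Real.cos (2 * π * x) + r ^ 2))
      (stepCoeff N ε r u)
      (fun x => (1 + 2 * r * Real.cos (2 * π * x) + r ^ 2) * S x + r * u N) := by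
  obtain ⟨h1, h2, h3, h4, h5⟩ := h
  refine ⟨stepCoeff_even N ε r u h1, fun n hn => if_neg (not_le.mpr hn), fun n => ?_, fun x => ?_,
    fun x => ?_⟩
  · by_cases hn : n = 0
    · rwa [hn]
    · rw [stepCoeff, if_neg hn]
      split_ifs
      · have := h3 n
        have := h3 (n - 1)
        have := h3 (n + 1)
        positivity
      · rfl
  · have := one_add_two_mul_cos_nonneg r (2 * π * x)
    have := h4 x
    have := h3 N
    positivity
  · have hs : u (N + 1) = 0 := h2 _ (by rw [abs_of_nonneg] <;> omega)
    have h6 := cosPoly_mul N u h1 hs r x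
    have h7 := cosPoly_stepCoeff N ε r u x
    simp only [h5 x, h7]
    linear_combination h6 - 2 * r * u N * Real.cos (2 * π * (N + 1) * x) * hε

theorem decomposes_one (N : ℕ) (ε : ℝ) :
    Decomposes N ε (fun _ => 1) (fun n => if n = 0 then 1 else 0) (fun _ => 0) := by
  refine ⟨fun n => by simp, fun n hn => if_neg ?_, fun n => by positivity, fun x => le_rfl,
    fun x => ?_⟩
  · rintro rfl
    simp at hn
    omega
  · have : ∀ n : ℤ, (if n = 0 then (1 : ℝ) else 0) * Real.cos (2 * π * n * x) =
        if n = 0 then 1 else 0 := by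
      intro n
      by_cases h : n = 0 <;> simp [h]
    simp [cosPoly, this]

/-- A finite product of Jacobi type, `∏ᵢ (1 + 2 rᵢ cos 2πx + rᵢ²)`. -/
def thetaProd (r : ℕ → ℝ) (K : ℕ) (x : ℝ) : ℝ :=
  ∏ i ∈ Finset.range K, (1 + 2 * r i * Real.cos (2 * π * x) + r i ^ 2)

theorem thetaProd_zero (r : ℕ → ℝ) : thetaProd r 0 = fun _ => 1 := by
  ext x
  simp [thetaProd]

theorem thetaProd_succ (r : ℕ → ℝ) (K : ℕ) :
    thetaProd r (K + 1) =
      fun x => thetaProd r K x * (1 + 2 * r K * Real.cos (2 * π * x) + r K ^ 2) := by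
  ext x
  rw [thetaProd, Finset.prod_range_succ, thetaProd]

theorem exists_decomposes_thetaProd_one (N : ℕ) (r : ℕ → ℝ) (hr : ∀ i, 0 ≤ r i) (K : ℕ) :
    ∃ u S, Decomposes N 1 (thetaProd r K) u S := by
  induction K with
  | zero =>
    rw [thetaProd_zero]
    exact ⟨_, _, decomposes_one N 1⟩
  | succ K ih =>
    obtain ⟨u, S, h⟩ := ih
    rw [thetaProd_succ]
    refine ⟨_, _, h.step (by norm_num) (hr K) ?_⟩
    have h3 := h.2.2.1
    have := h3 0
    have := h3 (0 - 1)
    have := h3 (0 + 1)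
    have := h3 N
    have := hr K
    rw [stepCoeff, if_pos (by simp), if_pos rfl]
    positivity

/-- The antiperiodic combinations `u n - u (N + 1 - n)` are nonnegative on the first half period. -/
def HalfPeriodNonneg (N : ℕ) (u : ℤ → ℝ) : Prop :=
  ∀ n : ℤ, 0 ≤ n → 2 * n ≤ N + 1 → 0 ≤ u n - u (N + 1 - n)

/-- For `ε = -1` the new zeroth coefficient is `(1 + r²) u₀ + 2r (u₁ - u_N)`, and the half-period
inequality at `n = 1` says `u₁ ≥ u_N`. -/
theorem stepCoeff_neg_one_zero_nonneg {N : ℕ} {u : ℤ → ℝ} (heven : ∀ n, u (-n) = u n)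
    (hsupp : ∀ n : ℤ, (N : ℤ) < |n| → u n = 0) (hnonneg : ∀ n, 0 ≤ u n)
    (hu : HalfPeriodNonneg N u) {r : ℝ} (hr : 0 ≤ r) : 0 ≤ stepCoeff N (-1) r u 0 := by
  have e : u (0 - 1) = u 1 := by rw [← heven]; rfl
  rw [stepCoeff, if_pos (by simp), if_pos rfl, e, zero_add]
  rcases Nat.eq_zero_or_pos N with rfl | hN
  -- For `N = 0` there is no `u₁`, and the coefficient is `(1 - r)² u₀`.
  · rw [hsupp 1 (by simp)]
    have := hnonneg 0
    simp only [Nat.cast_zero]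
    nlinarith [mul_nonneg (sq_nonneg (1 - r)) this]
  · have h1 := hu 1 (by norm_num) (by omega)
    rw [show (N : ℤ) + 1 - 1 = N by ring] at h1
    have := hnonneg 0
    have h2 := mul_nonneg hr h1
    nlinarith [mul_nonneg (sq_nonneg r) this]

/-- Away from `n = 0`, the differences `dₙ = uₙ - u_{N+1-n}` obey the same recursion `(1 + r²) dₙ +
r (dₙ₋₁ + dₙ₊₁)`. All its terms are nonnegative except near the centre, where `dₙ₊₁` leaves the half
period. -/
theorem HalfPeriodNonneg.step {N : ℕ} {u : ℤ → ℝ} (hu : HalfPeriodNonneg N u) {r : ℝ}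
    (hr : 0 ≤ r) (h0 : 0 ≤ stepCoeff N (-1) r u 0) :
    HalfPeriodNonneg N (stepCoeff N (-1) r u) := by
  intro n hn hn2
  rcases hn.eq_or_lt with rfl | hn1
  · have : stepCoeff N (-1) r u (N + 1 - 0) = 0 := by
      rw [stepCoeff, if_neg]
      rw [abs_of_nonneg] <;> omega
    rwa [this, sub_zero]
  · have e1 : |n| ≤ N := by rw [abs_of_nonneg] <;> omega
    have e2 : |(N : ℤ) + 1 - n| ≤ N := by rw [abs_of_nonneg] <;> omega
    have e3 : n ≠ 0 := by omega
    have e4 : (N : ℤ) + 1 - n ≠ 0 := by omega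
    simp only [stepCoeff, if_pos e1, if_pos e2, if_neg e3, if_neg e4]
    have b0 := hu n hn hn2
    have b1 := hu (n - 1) (by omega) (by omega)
    rw [show (N : ℤ) + 1 - (n - 1) = N + 1 - n + 1 by ring] at b1
    have b1' := mul_nonneg hr b1
    rcases lt_trichotomy (2 * n) N with hlt | heq | hgt
    · have b2 := hu (n + 1) (by omega) (by omega)
      rw [show (N : ℤ) + 1 - (n + 1) = N + 1 - n - 1 by ring] at b2
      nlinarith [mul_nonneg hr b2, mul_nonneg (sq_nonneg r) b0]
    -- Here `dₙ₊₁ = -dₙ`, so the coefficient of `dₙ` drops to `1 - r + r²`, which is still positive.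
    · have i1 : (N : ℤ) + 1 - n = n + 1 := by omega
      rw [i1] at b0 b1' ⊢
      rw [show n + 1 - 1 = n by ring]
      have : 0 ≤ 1 - r + r ^ 2 := by nlinarith [sq_nonneg (r - 1 / 2)]
      nlinarith [mul_nonneg this b0]
    · have i1 : (N : ℤ) + 1 - n = n := by omega
      rw [i1]
      linarith

theorem exists_decomposes_thetaProd_neg_one (N : ℕ) (r : ℕ → ℝ) (hr : ∀ i, 0 ≤ r i) (K : ℕ) :
    ∃ u S, Decomposes N (-1) (thetaProd r K) u S ∧ HalfPeriodNonneg N u := by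
  induction K with
  | zero =>
    rw [thetaProd_zero]
    refine ⟨_, _, decomposes_one N (-1), fun n hn hn2 => ?_⟩
    have : (N : ℤ) + 1 - n ≠ 0 := by omega
    simp only [if_neg this, sub_zero]
    positivity
  | succ K ih =>
    obtain ⟨u, S, h, hu⟩ := ih
    rw [thetaProd_succ]
    have h0 := stepCoeff_neg_one_zero_nonneg h.1 h.2.1 h.2.2.1 hu (hr K)
    exact ⟨_, _, h.step (by norm_num) (hr K) h0, hu.step (hr K) h0⟩

/-! ### Coefficients of the finite Jacobi triple product. -/

/-- The ratio of `q`-binomial coefficients `[2K, K+k]_Q / [2K, K]_Q`. -/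
def qBinomRatio (Q : ℝ) (K k : ℕ) : ℝ :=
  ∏ i ∈ Finset.range k, (1 - Q ^ (K - i)) / (1 - Q ^ (K + 1 + i))

theorem qBinomRatio_succ (Q : ℝ) (K k : ℕ) : qBinomRatio Q K (k + 1) =
    qBinomRatio Q K k * ((1 - Q ^ (K - k)) / (1 - Q ^ (K + 1 + k))) :=
  Finset.prod_range_succ _ _

theorem qBinomRatio_eq_zero (Q : ℝ) {K k : ℕ} (h : K < k) : qBinomRatio Q K k = 0 :=
  Finset.prod_eq_zero (Finset.mem_range.mpr h) (by simp)

theorem one_sub_pow_pos {Q : ℝ} (h0 : 0 < Q) (h1 : Q < 1) (n : ℕ) : 0 < 1 - Q ^ (n + 1) :=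
  sub_pos.mpr (pow_lt_one₀ h0.le h1 (Nat.succ_ne_zero n))

theorem qBinomRatio_nonneg {Q : ℝ} (h0 : 0 < Q) (h1 : Q < 1) (K k : ℕ) : 0 ≤ qBinomRatio Q K k := by
  refine Finset.prod_nonneg fun i _ => div_nonneg ?_ ?_
  · exact sub_nonneg.mpr (pow_le_one₀ h0.le h1.le)
  · exact sub_nonneg.mpr (pow_le_one₀ h0.le h1.le)

/-- Each denominator has the larger exponent. The bound is uniform in `K`, so the theta weights
dominate the coefficients of all finite products. -/
theorem qBinomRatio_le_one {Q : ℝ} (h0 : 0 < Q) (h1 : Q < 1) (K k : ℕ) : qBinomRatio Q K k ≤ 1 := by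
  refine Finset.prod_le_one (fun i _ => div_nonneg ?_ ?_) fun i _ => ?_
  · exact sub_nonneg.mpr (pow_le_one₀ h0.le h1.le)
  · exact sub_nonneg.mpr (pow_le_one₀ h0.le h1.le)
  · have := one_sub_pow_pos h0 h1 (K + i)
    rw [show K + i + 1 = K + 1 + i by ring] at this
    rw [div_le_one this]
    have : Q ^ (K + 1 + i) ≤ Q ^ (K - i) := pow_le_pow_of_le_one h0.le h1.le (by omega)
    linarith

theorem tendsto_qBinomRatio {Q : ℝ} (h0 : 0 < Q) (h1 : Q < 1) (k : ℕ) :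
    Filter.Tendsto (fun K => qBinomRatio Q K k) Filter.atTop (nhds 1) := by
  have h : ∀ i : ℕ, Filter.Tendsto (fun K => (1 - Q ^ (K - i)) / (1 - Q ^ (K + 1 + i)))
      Filter.atTop (nhds ((1 - 0) / (1 - 0))) := by
    intro i
    have hp := tendsto_pow_atTop_nhds_zero_of_lt_one h0.le h1
    refine Filter.Tendsto.div (Filter.Tendsto.const_sub _ ?_) (Filter.Tendsto.const_sub _ ?_)
      (by norm_num)
    · exact hp.comp (Filter.tendsto_sub_atTop_nat i)
    · simpa [add_assoc] using (Filter.tendsto_add_atTop_iff_nat (1 + i)).mpr hp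
  have := tendsto_finsetProd (Finset.range k) (fun i _ => h i)
  simpa [qBinomRatio] using this

/-- Raising `K` and `n` together leaves most factors in place. This makes every term of the
coefficient recursion a multiple of the single quantity `qBinomRatio Q K n`. -/
theorem qBinomRatio_succ_succ {Q : ℝ} (h0 : 0 < Q) (h1 : Q < 1) (K n : ℕ) : qBinomRatio Q (K + 1)
    (n + 1) =
    qBinomRatio Q K n * (1 - Q ^ (K + 1)) ^ 2 /
      ((1 - Q ^ (K + 1 + n)) * (1 - Q ^ (K + 2 + n))) := by
  have hK := (one_sub_pow_pos h0 h1 K).ne'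
  induction n with
  | zero =>
    have hK' := (one_sub_pow_pos h0 h1 (K + 1)).ne'
    simp only [qBinomRatio, Finset.prod_range_succ, Finset.prod_range_zero]
    simp only [add_zero, Nat.sub_zero, one_mul, add_assoc, Nat.reduceAdd] at *
    field_simp
  | succ n ih =>
    have e1 := (one_sub_pow_pos h0 h1 (K + n)).ne'
    have e2 := (one_sub_pow_pos h0 h1 (K + 1 + n)).ne'
    have e3 := (one_sub_pow_pos h0 h1 (K + 2 + n)).ne'
    rw [qBinomRatio_succ, ih, qBinomRatio_succ, show K + 1 - (n + 1) = K - n by omega]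
    rw [show K + n + 1 = K + 1 + n by ring] at e1
    rw [show K + 1 + n + 1 = K + 2 + n by ring] at e2
    rw [show K + 1 + 1 + (n + 1) = K + 2 + n + 1 by ring, show K + 1 + (n + 1) = K + 2 + n by ring]
    field_simp

/-- The normalising factors in the finite form of the Jacobi triple product. -/
def tripleFactor (q : ℝ) (K : ℕ) : ℝ :=
  (1 - (q ^ 2) ^ (2 * K + 1)) * (1 - (q ^ 2) ^ (2 * K + 2)) / (1 - (q ^ 2) ^ (K + 1)) ^ 2

/-- The normalised coefficients in the finite form of the Jacobi triple product. -/
def tripleCoeff (q : ℝ) (K k : ℕ) : ℝ := q ^ (k ^ 2) * qBinomRatio (q ^ 2) K k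

theorem tripleFactor_pos {q : ℝ} (h0 : 0 < q) (h1 : q < 1) (K : ℕ) : 0 < tripleFactor q K := by
  have hQ0 : 0 < q ^ 2 := by positivity
  have hQ1 : q ^ 2 < 1 := pow_lt_one₀ h0.le h1 two_ne_zero
  exact div_pos (mul_pos (one_sub_pow_pos hQ0 hQ1 _) (one_sub_pow_pos hQ0 hQ1 (2 * K + 1)))
    (pow_pos (one_sub_pow_pos hQ0 hQ1 _) 2)

theorem tripleCoeff_succ_zero {q : ℝ} (h0 : 0 < q) (h1 : q < 1) (K : ℕ) : tripleFactor q K *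
    tripleCoeff q (K + 1) 0 =
    (1 + (q ^ (2 * K + 1)) ^ 2) * tripleCoeff q K 0 +
      q ^ (2 * K + 1) * (2 * tripleCoeff q K 1) := by
  have hQ0 : 0 < q ^ 2 := by positivity
  have hQ1 : q ^ 2 < 1 := pow_lt_one₀ h0.le h1 two_ne_zero
  have e1 := (one_sub_pow_pos hQ0 hQ1 K).ne'
  simp only [tripleFactor, tripleCoeff, qBinomRatio, Finset.prod_range_succ,
    Finset.prod_range_zero, Nat.sub_zero, add_zero]
  field_simp
  ring

/-- This is the effect on coefficients of multiplying by `1 + 2r cos 2πx + r²` with `r = q^(2K+1)`.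
The central coefficient is normalised to `1`, and `tripleFactor` is its growth. -/
theorem tripleCoeff_succ_succ {q : ℝ} (h0 : 0 < q) (h1 : q < 1) (K n : ℕ) : tripleFactor q K *
    tripleCoeff q (K + 1) (n + 1) =
    (1 + (q ^ (2 * K + 1)) ^ 2) * tripleCoeff q K (n + 1) +
      q ^ (2 * K + 1) * (tripleCoeff q K n + tripleCoeff q K (n + 2)) := by
  have hQ0 : 0 < q ^ 2 := by positivity
  have hQ1 : q ^ 2 < 1 := pow_lt_one₀ h0.le h1 two_ne_zero
  have e0 := (one_sub_pow_pos hQ0 hQ1 K).ne'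
  have e1 := (one_sub_pow_pos hQ0 hQ1 (K + n)).ne'
  have e2 := (one_sub_pow_pos hQ0 hQ1 (K + 1 + n)).ne'
  rw [show K + n + 1 = K + 1 + n by ring] at e1
  rw [show K + 1 + n + 1 = K + 2 + n by ring] at e2
  simp only [tripleFactor, tripleCoeff]
  rw [qBinomRatio_succ_succ hQ0 hQ1, show n + 2 = n + 1 + 1 from rfl,
    qBinomRatio_succ _ K (n + 1), qBinomRatio_succ _ K n,
    show K + 1 + (n + 1) = K + 2 + n by ring]
  -- The cases separate the truncated subtractions `K - n` and `K - (n + 1)`: for `K < n` everything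
  -- vanishes, and for `K = n` only the `n`th term on the right survives.
  rcases lt_trichotomy K n with h | h | h
  · simp [qBinomRatio_eq_zero _ h]
  · subst h
    rw [show K + 1 + K = 2 * K + 1 by ring] at e1 ⊢
    rw [show K + 2 + K = 2 * K + 2 by ring] at e2 ⊢
    have : K - (K + 1) = 0 := by omega
    simp only [this, Nat.sub_self, pow_zero, sub_self, zero_div, mul_zero, add_zero, zero_add]
    field_simp
    ring
  · obtain ⟨m, rfl⟩ := Nat.exists_eq_add_of_lt h
    rw [show n + m + 1 - n = m + 1 by omega, show n + m + 1 - (n + 1) = m by omega]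
    field_simp
    ring

/-! ### Cosine series dominated by theta weights, and their limits. -/

/-- The coefficients `e^{-πTn²}` of the theta series. -/
def thetaWeight (T : ℝ) (n : ℤ) : ℝ := Real.exp (-π * T * n ^ 2)

theorem thetaWeight_eq_pow (T : ℝ) (n : ℤ) :
    thetaWeight T n = Real.exp (-π * T) ^ (n.natAbs ^ 2) := by
  rw [thetaWeight, ← Real.exp_nat_mul]
  congr 1
  push_cast
  rw [Nat.cast_natAbs, Int.cast_abs, sq_abs]
  ring

theorem summable_pow_mul_thetaWeight {T : ℝ} (hT : 0 < T) (k : ℕ) :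
    Summable fun n : ℤ => |(n : ℝ)| ^ k * thetaWeight T n := by
  refine (summable_pow_mul_jacobiTheta₂_term_bound 0 hT k).congr fun n => ?_
  rw [thetaWeight, Int.cast_abs]
  congr 2
  ring

theorem summable_thetaWeight {T : ℝ} (hT : 0 < T) : Summable (thetaWeight T) := by
  simpa using summable_pow_mul_thetaWeight hT 0

/-- The cosine series with coefficients `b`. -/
def cosSeries (b : ℤ → ℝ) (x : ℝ) : ℝ := ∑' n : ℤ, b n * Real.cos (2 * π * n * x)

/-- The termwise derivative of `cosSeries`. -/
def cosSeriesDeriv (b : ℤ → ℝ) (x : ℝ) : ℝ :=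
  ∑' n : ℤ, b n * (-Real.sin (2 * π * n * x) * (2 * π * n))

theorem abs_mul_neg_sin_le {c w : ℝ} (h : |c| ≤ w) (n : ℤ) (x : ℝ) :
    |c * (-Real.sin (2 * π * n * x) * (2 * π * n))| ≤ 2 * π * (|(n : ℝ)| ^ 1 * w) := by
  have h1 := Real.abs_sin_le_one (2 * π * n * x)
  rw [abs_mul, abs_mul, abs_neg, abs_mul, abs_of_pos Real.two_pi_pos, pow_one]
  have h2 : |Real.sin (2 * π * n * x)| * (2 * π * |(n : ℝ)|) ≤ 1 * (2 * π * |(n : ℝ)|) := by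
    gcongr
  calc _ ≤ w * (1 * (2 * π * |(n : ℝ)|)) := by gcongr; exact (abs_nonneg _).trans h
    _ = _ := by ring

theorem abs_mul_cos_le {c w : ℝ} (h : |c| ≤ w) (x : ℝ) : |c * Real.cos x| ≤ w := by
  rw [abs_mul]
  calc _ ≤ |c| * 1 := by gcongr; exact Real.abs_cos_le_one x
    _ ≤ w := by simpa using h

theorem summable_mul_cos {T : ℝ} (hT : 0 < T) {b : ℤ → ℝ} (hb : ∀ n, |b n| ≤ thetaWeight T n)
    (φ : ℤ → ℝ) : Summable fun n : ℤ => b n * Real.cos (φ n) :=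
  Summable.of_norm_bounded (summable_thetaWeight hT) fun n => abs_mul_cos_le (hb n) _

theorem hasDerivAt_cosSeries {T : ℝ} (hT : 0 < T) {b : ℤ → ℝ}
    (hb : ∀ n, |b n| ≤ thetaWeight T n) (x : ℝ) :
    HasDerivAt (cosSeries b) (cosSeriesDeriv b x) x := by
  have hd : ∀ (n : ℤ) (y : ℝ), HasDerivAt (fun y => b n * Real.cos (2 * π * n * y))
      (b n * (-Real.sin (2 * π * n * y) * (2 * π * n))) y := by
    intro n y
    refine HasDerivAt.const_mul _ (HasDerivAt.cos ?_)
    simpa using (hasDerivAt_id y).const_mul (2 * π * (n : ℝ))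
  exact hasDerivAt_tsum ((summable_pow_mul_thetaWeight hT 1).mul_left (2 * π)) hd
    (fun n y => abs_mul_neg_sin_le (hb n) n y) (y₀ := 0) (summable_mul_cos hT hb _) x

theorem tendsto_cosSeries {T : ℝ} (hT : 0 < T) {b : ℕ → ℤ → ℝ} {c : ℤ → ℝ}
    (hb : ∀ K n, |b K n| ≤ thetaWeight T n)
    (hlim : ∀ n, Filter.Tendsto (fun K => b K n) Filter.atTop (nhds (c n))) (x : ℝ) :
    Filter.Tendsto (fun K => cosSeries (b K) x) Filter.atTop (nhds (cosSeries c x)) :=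
  tendsto_tsum_of_dominated_convergence (summable_thetaWeight hT)
    (fun n => (hlim n).mul_const _)
    (Filter.Eventually.of_forall fun K n => abs_mul_cos_le (hb K n) _)

theorem tendsto_cosSeriesDeriv {T : ℝ} (hT : 0 < T) {b : ℕ → ℤ → ℝ} {c : ℤ → ℝ}
    (hb : ∀ K n, |b K n| ≤ thetaWeight T n)
    (hlim : ∀ n, Filter.Tendsto (fun K => b K n) Filter.atTop (nhds (c n))) (x : ℝ) :
    Filter.Tendsto (fun K => cosSeriesDeriv (b K) x) Filter.atTop (nhds (cosSeriesDeriv c x)) :=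
  tendsto_tsum_of_dominated_convergence
    ((summable_pow_mul_thetaWeight hT 1).mul_left (2 * π))
    (fun n => (hlim n).mul_const _)
    (Filter.Eventually.of_forall fun K n => abs_mul_neg_sin_le (hb K n) n x)

/-- The infinite analogue of `cosPoly_mul`: absolute convergence permits the index shifts, and there
is no boundary term. -/
theorem cosSeries_mul {T : ℝ} (hT : 0 < T) {b : ℤ → ℝ} (hb : ∀ n, |b n| ≤ thetaWeight T n)
    (r x : ℝ) : cosSeries b x * (1 + 2 * r * Real.cos (2 * π * x) + r ^ 2) =
      cosSeries (fun n => (1 + r ^ 2) * b n + r * (b (n - 1) + b (n + 1))) x := by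
  have s0 : Summable fun n : ℤ => b n * Real.cos (2 * π * n * x) := summable_mul_cos hT hb _
  have s1 : Summable fun n : ℤ => b n * Real.cos (2 * π * ((n + 1 : ℤ) : ℝ) * x) :=
    summable_mul_cos hT hb _
  have s2 : Summable fun n : ℤ => b n * Real.cos (2 * π * ((n - 1 : ℤ) : ℝ) * x) :=
    summable_mul_cos hT hb _
  have s1' : Summable fun n : ℤ => b (n - 1) * Real.cos (2 * π * n * x) := by
    refine ((Equiv.addRight (1 : ℤ)).summable_iff).mp (s1.congr fun n => ?_)
    simp
  have s2' : Summable fun n : ℤ => b (n + 1) * Real.cos (2 * π * n * x) := by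
    refine ((Equiv.addRight (-1 : ℤ)).summable_iff).mp (s2.congr fun n => ?_)
    simp [sub_eq_add_neg]
  have t1 : ∑' n : ℤ, b n * Real.cos (2 * π * ((n + 1 : ℤ) : ℝ) * x) =
      ∑' n : ℤ, b (n - 1) * Real.cos (2 * π * n * x) := by
    rw [← (Equiv.addRight (1 : ℤ)).tsum_eq fun n : ℤ => b (n - 1) * Real.cos (2 * π * n * x)]
    simp
  have t2 : ∑' n : ℤ, b n * Real.cos (2 * π * ((n - 1 : ℤ) : ℝ) * x) =
      ∑' n : ℤ, b (n + 1) * Real.cos (2 * π * n * x) := by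
    rw [← (Equiv.addRight (-1 : ℤ)).tsum_eq fun n : ℤ => b (n + 1) * Real.cos (2 * π * n * x)]
    simp [sub_eq_add_neg]
  have e : ∀ n : ℤ, ((1 + r ^ 2) * b n + r * (b (n - 1) + b (n + 1))) * Real.cos (2 * π * n * x) =
      (1 + r ^ 2) * (b n * Real.cos (2 * π * n * x)) +
      (r * (b (n - 1) * Real.cos (2 * π * n * x)) +
        r * (b (n + 1) * Real.cos (2 * π * n * x))) := fun n => by ring
  have e' : ∀ n : ℤ, b n * Real.cos (2 * π * n * x) *
      (1 + 2 * r * Real.cos (2 * π * x) + r ^ 2) =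
      (1 + r ^ 2) * (b n * Real.cos (2 * π * n * x)) +
      (r * (b n * Real.cos (2 * π * ((n + 1 : ℤ) : ℝ) * x)) +
        r * (b n * Real.cos (2 * π * ((n - 1 : ℤ) : ℝ) * x))) := by
    intro n
    push_cast
    rw [show 2 * π * (n + 1) * x = 2 * π * n * x + 2 * π * x by ring,
      show 2 * π * (n - 1) * x = 2 * π * n * x - 2 * π * x by ring, Real.cos_add, Real.cos_sub]
    ring
  rw [cosSeries, cosSeries, ← tsum_mul_right, tsum_congr e, tsum_congr e',
    (s0.mul_left _).tsum_add ((s1.mul_left _).add (s2.mul_left _)),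
    (s0.mul_left _).tsum_add ((s1'.mul_left _).add (s2'.mul_left _)),
    (s1.mul_left _).tsum_add (s2.mul_left _), (s1'.mul_left _).tsum_add (s2'.mul_left _),
    tsum_mul_left, tsum_mul_left, tsum_mul_left, tsum_mul_left, tsum_mul_left, t1, t2]

/-! ### Finite Jacobi products as cosine series. -/

/-- The normalised coefficients of the finite Jacobi product, indexed by `ℤ`. -/
def thetaApproxCoeff (T : ℝ) (K : ℕ) (n : ℤ) : ℝ := tripleCoeff (Real.exp (-π * T)) K n.natAbs

theorem exp_neg_pi_mul_lt_one {T : ℝ} (hT : 0 < T) : Real.exp (-π * T) < 1 :=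
  Real.exp_lt_one_iff.mpr (by nlinarith [Real.pi_pos])

theorem sq_exp_lt_one {T : ℝ} (hT : 0 < T) : Real.exp (-π * T) ^ 2 < 1 :=
  pow_lt_one₀ (Real.exp_pos _).le (exp_neg_pi_mul_lt_one hT) two_ne_zero

theorem abs_thetaApproxCoeff_le {T : ℝ} (hT : 0 < T) (K : ℕ) (n : ℤ) :
    |thetaApproxCoeff T K n| ≤ thetaWeight T n := by
  have hq : 0 < Real.exp (-π * T) ^ 2 := by positivity
  have h1 := qBinomRatio_nonneg hq (sq_exp_lt_one hT) K n.natAbs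
  have h2 := qBinomRatio_le_one hq (sq_exp_lt_one hT) K n.natAbs
  rw [thetaApproxCoeff, tripleCoeff, abs_of_nonneg (by positivity), thetaWeight_eq_pow]
  exact mul_le_of_le_one_right (by positivity) h2

theorem tendsto_thetaApproxCoeff {T : ℝ} (hT : 0 < T) (n : ℤ) :
    Filter.Tendsto (fun K => thetaApproxCoeff T K n) Filter.atTop (nhds (thetaWeight T n)) := by
  have h := tendsto_qBinomRatio (Q := Real.exp (-π * T) ^ 2) (by positivity) (sq_exp_lt_one hT)
    n.natAbs
  simpa [thetaApproxCoeff, tripleCoeff, thetaWeight_eq_pow] using h.const_mul _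

theorem thetaApproxCoeff_succ {T : ℝ} (hT : 0 < T) (K : ℕ) (n : ℤ) :
    tripleFactor (Real.exp (-π * T)) K * thetaApproxCoeff T (K + 1) n =
      (1 + (Real.exp (-π * T) ^ (2 * K + 1)) ^ 2) * thetaApproxCoeff T K n +
      Real.exp (-π * T) ^ (2 * K + 1) *
        (thetaApproxCoeff T K (n - 1) + thetaApproxCoeff T K (n + 1)) := by
  have h0 := Real.exp_pos (-π * T)
  have h1 := exp_neg_pi_mul_lt_one hT
  unfold thetaApproxCoeff
  rcases lt_trichotomy n 0 with h | rfl | h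
  · obtain ⟨m, rfl⟩ : ∃ m : ℕ, n = -(m + 1 : ℕ) := ⟨n.natAbs - 1, by omega⟩
    have := tripleCoeff_succ_succ h0 h1 K m
    rw [show (-((m + 1 : ℕ) : ℤ)).natAbs = m + 1 by omega,
      show (-((m + 1 : ℕ) : ℤ) - 1).natAbs = m + 2 by omega,
      show (-((m + 1 : ℕ) : ℤ) + 1).natAbs = m by omega, this]
    ring
  · have := tripleCoeff_succ_zero h0 h1 K
    simpa [two_mul] using this
  · obtain ⟨m, rfl⟩ : ∃ m : ℕ, n = (m + 1 : ℕ) := ⟨n.natAbs - 1, by omega⟩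
    have := tripleCoeff_succ_succ h0 h1 K m
    rw [show ((m + 1 : ℕ) : ℤ).natAbs = m + 1 by omega,
      show (((m + 1 : ℕ) : ℤ) - 1).natAbs = m by omega,
      show (((m + 1 : ℕ) : ℤ) + 1).natAbs = m + 2 by omega, this]

/-- The finite form of the Jacobi triple product. -/
theorem exists_thetaProd_eq {T : ℝ} (hT : 0 < T) (K : ℕ) : ∃ C : ℝ, 0 < C ∧
    ∀ x, thetaProd (fun i => Real.exp (-π * T) ^ (2 * i + 1)) K x =
      C * cosSeries (thetaApproxCoeff T K) x := by
  have h0 := Real.exp_pos (-π * T)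
  have h1 := exp_neg_pi_mul_lt_one hT
  induction K with
  | zero =>
    refine ⟨1, one_pos, fun x => ?_⟩
    rw [cosSeries, tsum_eq_single 0]
    · simp [thetaProd, thetaApproxCoeff, tripleCoeff, qBinomRatio]
    · intro n hn
      rw [thetaApproxCoeff, tripleCoeff, qBinomRatio_eq_zero _ (by omega)]
      simp
  | succ K ih =>
    obtain ⟨C, hC, h⟩ := ih
    refine ⟨C * tripleFactor (Real.exp (-π * T)) K, mul_pos hC (tripleFactor_pos h0 h1 K),
      fun x => ?_⟩
    rw [thetaProd_succ]
    simp only [h x]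
    rw [mul_assoc, cosSeries_mul hT (abs_thetaApproxCoeff_le hT K), mul_assoc]
    simp only [← thetaApproxCoeff_succ hT K]
    simp only [cosSeries, mul_assoc, tsum_mul_left]

/-! ### Closed forms of the two interpolation kernels. -/

/-- The Fejér kernel of degree `N`, normalised to take the value `1` at `0`. -/
def fejerKernel (N : ℕ) (y : ℝ) : ℝ :=
  1 / ((N : ℝ) + 1) ^ 2 *
    ∑ c ∈ Finset.Icc (-(N : ℤ)) N, ((N : ℝ) + 1 - |(c : ℝ)|) * Real.cos (2 * π * c * y)

/-- The kernel reproducing derivatives at the zeros of `sin (π(N+1)y)`. -/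
def conjFejerKernel (N : ℕ) (y : ℝ) : ℝ :=
  1 / (2 * π * ((N : ℝ) + 1) ^ 2) *
    (∑ c ∈ Finset.Icc (-(N : ℤ)) N, (c.sign : ℝ) * Real.sin (2 * π * c * y) +
      Real.sin (2 * π * (N + 1) * y))

theorem dirichlet_mul_sin (N : ℕ) (y : ℝ) :
    (∑ c ∈ Finset.Icc (-(N : ℤ)) N, Real.cos (2 * π * c * y)) * Real.sin (π * y) =
      Real.sin (2 * π * N * y + π * y) := by
  induction N with
  | zero => simp
  | succ N ih =>
    rw [sum_Icc_neg_succ, add_mul, ih]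
    push_cast
    rw [show 2 * π * (-((N : ℝ) + 1)) * y = -(2 * π * (N + 1) * y) by ring, Real.cos_neg,
      show 2 * π * (N : ℝ) * y + π * y = 2 * π * (N + 1) * y - π * y by ring, Real.sin_sub,
      Real.sin_add]
    ring

/-- Passing from `N` to `N+1` adds a Dirichlet kernel to the unnormalised sum, which drives the
induction. -/
theorem fejerKernel_mul_sin_sq (N : ℕ) (y : ℝ) :
    ((N : ℝ) + 1) ^ 2 * fejerKernel N y * Real.sin (π * y) ^ 2 =
      Real.sin (π * (N + 1) * y) ^ 2 := by
  have h0 : ((N : ℝ) + 1) ^ 2 ≠ 0 := by positivity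
  rw [fejerKernel, ← mul_assoc, mul_one_div_cancel h0, one_mul]
  clear h0
  induction N with
  | zero => simp
  | succ N ih =>
    have h1 := sum_Icc_neg_succ N
      (fun c : ℤ => ((N : ℝ) + 1 - |(c : ℝ)|) * Real.cos (2 * π * c * y))
    have h2 := dirichlet_mul_sin (N + 1) y
    have h3 : |-((N : ℝ) + 1)| = N + 1 := by rw [abs_neg, abs_of_nonneg (by positivity)]
    have h4 : |(N : ℝ) + 1| = N + 1 := by rw [abs_of_nonneg (by positivity)]
    have h5 : ∀ c : ℤ, (((N + 1 : ℕ) : ℝ) + 1 - |(c : ℝ)|) * Real.cos (2 * π * c * y) =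
        ((N : ℝ) + 1 - |(c : ℝ)|) * Real.cos (2 * π * c * y) + Real.cos (2 * π * c * y) := by
      intro c
      push_cast
      ring
    simp only [h5, Finset.sum_add_distrib]
    rw [h1]
    push_cast at *
    rw [h3, h4, sub_self, zero_mul, zero_mul, add_zero, add_zero, add_mul, ih, sq (Real.sin (π * y)),
      ← mul_assoc, h2, show π * (N + 1 + 1) * y = π * (N + 1) * y + π * y by ring,
      show 2 * π * (N + 1) * y + π * y = 2 * (π * (N + 1) * y) + π * y by ring, Real.sin_add,
      Real.sin_add, Real.sin_two_mul, Real.cos_two_mul]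
    have t1 := Real.sin_sq_add_cos_sq (π * (N + 1) * y)
    have t2 := Real.sin_sq_add_cos_sq (π * y)
    linear_combination Real.sin (π * y) ^ 2 * t1 - Real.sin (π * (N + 1) * y) ^ 2 * t2

theorem sum_sign_sin_mul_sin (N : ℕ) (y : ℝ) :
    (∑ c ∈ Finset.Icc (-(N : ℤ)) N, (c.sign : ℝ) * Real.sin (2 * π * c * y)) * Real.sin (π * y) =
      Real.cos (π * y) - Real.cos (2 * π * N * y + π * y) := by
  induction N with
  | zero => simp
  | succ N ih =>
    have s1 : ((N : ℤ) + 1).sign = 1 := Int.sign_eq_one_of_pos (by positivity)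
    have s2 : (-((N : ℤ) + 1)).sign = -1 := Int.sign_eq_neg_one_of_neg (by omega)
    rw [sum_Icc_neg_succ, add_mul, ih, s1, s2]
    push_cast
    rw [show 2 * π * (-((N : ℝ) + 1)) * y = -(2 * π * (N + 1) * y) by ring, Real.sin_neg,
      show 2 * π * (N : ℝ) * y + π * y = 2 * π * (N + 1) * y - π * y by ring, Real.cos_sub,
      Real.cos_add]
    ring

/-- The extra term of frequency `N+1` in the kernel is what produces the factor `sin²(π(N+1)y)`,
hence double zeros at the other nodes. At `0` the kernel vanishes with slope `1`. -/
theorem conjFejerKernel_mul_sin (N : ℕ) (y : ℝ) :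
    π * ((N : ℝ) + 1) ^ 2 * conjFejerKernel N y * Real.sin (π * y) =
      Real.sin (π * (N + 1) * y) ^ 2 * Real.cos (π * y) := by
  have h := sum_sign_sin_mul_sin N y
  have h1 : Real.cos (2 * π * N * y + π * y) =
      (1 - 2 * Real.sin (π * (N + 1) * y) ^ 2) * Real.cos (π * y) +
        Real.sin (2 * π * (N + 1) * y) * Real.sin (π * y) := by
    rw [show 2 * π * (N : ℝ) * y + π * y = 2 * (π * (N + 1) * y) - π * y by ring, Real.cos_sub,
      Real.cos_two_mul, show 2 * π * ((N : ℝ) + 1) * y = 2 * (π * (N + 1) * y) by ring,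
      Real.cos_sq']
    ring
  have h2 : ((N : ℝ) + 1) ≠ 0 := by positivity
  have h3 := Real.pi_ne_zero
  rw [h1] at h
  rw [conjFejerKernel]
  have h4 : π * ((N : ℝ) + 1) ^ 2 * (1 / (2 * π * ((N : ℝ) + 1) ^ 2)) = 1 / 2 := by field_simp
  rw [← mul_assoc, h4]
  linear_combination h / 2

theorem fejerKernel_periodic (N : ℕ) : Function.Periodic (fejerKernel N) 1 := by
  intro y
  simp only [fejerKernel]
  congr 1
  refine Finset.sum_congr rfl fun c _ => ?_
  rw [show 2 * π * c * (y + 1) = 2 * π * c * y + c * (2 * π) by ring, Real.cos_add_int_mul_two_pi]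

theorem conjFejerKernel_periodic (N : ℕ) : Function.Periodic (conjFejerKernel N) 1 := by
  intro y
  simp only [conjFejerKernel]
  congr 2
  · refine Finset.sum_congr rfl fun c _ => ?_
    rw [show 2 * π * c * (y + 1) = 2 * π * c * y + c * (2 * π) by ring,
      Real.sin_add_int_mul_two_pi]
  · rw [show 2 * π * ((N : ℝ) + 1) * (y + 1) = 2 * π * (N + 1) * y + ((N + 1 : ℕ) : ℤ) * (2 * π) by
      push_cast; ring, Real.sin_add_int_mul_two_pi]

theorem fejerKernel_zero (N : ℕ) : fejerKernel N 0 = 1 := by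
  have h : ∀ N : ℕ, ∑ c ∈ Finset.Icc (-(N : ℤ)) N, ((N : ℝ) + 1 - |(c : ℝ)|) =
      ((N : ℝ) + 1) ^ 2 := by
    intro N
    induction N with
    | zero => simp
    | succ N ih =>
      have h1 := sum_Icc_neg_succ N (fun c : ℤ => ((N : ℝ) + 1 - |(c : ℝ)|))
      have h3 : |-((N : ℝ) + 1)| = N + 1 := by rw [abs_neg, abs_of_nonneg (by positivity)]
      have h4 : |(N : ℝ) + 1| = N + 1 := by rw [abs_of_nonneg (by positivity)]
      have h5 : ∀ c : ℤ, (((N + 1 : ℕ) : ℝ) + 1 - |(c : ℝ)|) =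
          ((N : ℝ) + 1 - |(c : ℝ)|) + 1 := by
        intro c
        push_cast
        ring
      simp only [h5, Finset.sum_add_distrib]
      rw [h1, ih]
      push_cast
      rw [h3, h4]
      simp only [Finset.sum_const, Int.card_Icc, nsmul_eq_mul, mul_one]
      rw [show ((N : ℤ) + 1 + 1 - -((N : ℤ) + 1)).toNat = 2 * N + 3 by omega]
      push_cast
      ring
  have h2 : ((N : ℝ) + 1) ^ 2 ≠ 0 := by positivity
  simp only [fejerKernel, mul_zero, Real.cos_zero, mul_one, h]
  field_simp

theorem conjFejerKernel_zero (N : ℕ) : conjFejerKernel N 0 = 0 := by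
  simp [conjFejerKernel]

/-! ### Periodization of `sinc²` and `y sinc²`. -/

theorem sinc_pi_int {n : ℤ} (hn : n ≠ 0) : Real.sinc (π * n) = 0 := by
  rw [Real.sinc_of_ne_zero (mul_ne_zero Real.pi_ne_zero (by exact_mod_cast hn)), mul_comm,
    Real.sin_int_mul_pi, zero_div]

theorem mul_sinc (x : ℝ) : x * Real.sinc x = Real.sin x := by
  rcases eq_or_ne x 0 with rfl | h
  · simp
  · rw [Real.sinc_of_ne_zero h, mul_div_cancel₀ _ h]

theorem sin_pi_mul_add_int_sq (δ : ℕ) (y : ℝ) (n : ℤ) :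
    Real.sin (π * (δ * (y + n))) ^ 2 = Real.sin (π * δ * y) ^ 2 := by
  have e : π * (δ * (y + n)) = π * δ * y + ((δ * n : ℤ) : ℝ) * π := by push_cast; ring
  rw [e, Real.sin_add_int_mul_pi, mul_pow, ← zpow_natCast, ← zpow_mul, mul_comm (_ * n : ℤ),
    zpow_mul]
  norm_num

/-- Parseval's identity for `t ↦ e(-yt)` on a unit interval. -/
theorem hasSum_sinc_sq (y : ℝ) : HasSum (fun n : ℤ => Real.sinc (π * (y + n)) ^ 2) 1 := by
  have hab : (-1 / 2 : ℝ) < 1 / 2 := by norm_num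
  set f : ℝ → ℂ := fun x => Complex.exp (-(2 * π * Complex.I * y) * x) with hf
  have hfn : ∀ x, ‖f x‖ = 1 := by
    intro x
    rw [hf]
    simp only
    rw [show -(2 * π * Complex.I * y) * (x : ℂ) = ((-(2 * π * y * x) : ℝ) : ℂ) * Complex.I by
      push_cast; ring, Complex.norm_exp_ofReal_mul_I]
  have hL : MeasureTheory.MemLp f 2 (MeasureTheory.volume.restrict (Set.Ioc (-1 / 2) (1 / 2))) :=
    MeasureTheory.MemLp.of_bound (by rw [hf]; fun_prop) 1
      (Filter.Eventually.of_forall fun x => (hfn x).le)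
  have h := hasSum_sq_fourierCoeffOn hab hL
  have hint : ((1 / 2 : ℝ) - -1 / 2)⁻¹ • ∫ x in (-1 / 2 : ℝ)..1 / 2, ‖f x‖ ^ 2 = 1 := by
    simp only [hfn]
    norm_num
  rw [hint] at h
  have hco : ∀ n : ℤ, ‖fourierCoeffOn hab f n‖ ^ 2 = Real.sinc (π * (y + n)) ^ 2 := by
    intro n
    have hcoe : fourierCoeffOn hab f n = (Real.sinc (π * (y + n)) : ℂ) := by
      have hfun : ∀ x : ℝ, fourier (-n) (x : AddCircle ((1 / 2 : ℝ) - -1 / 2)) • f x =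
          Complex.exp ((-(2 * π * Complex.I * ((y + n : ℝ) : ℂ))) * x) := by
        intro x
        rw [fourier_coe_apply, smul_eq_mul, hf, ← Complex.exp_add]
        congr 1
        push_cast
        norm_num
        ring
      rw [fourierCoeffOn_eq_integral]
      simp only [hfun]
      rcases eq_or_ne (y + n) 0 with h0 | h0
      · rw [h0]
        norm_num
      · have hc : -(2 * π * Complex.I * ((y + n : ℝ) : ℂ)) ≠ 0 := by
          refine neg_ne_zero.mpr (mul_ne_zero Complex.two_pi_I_ne_zero ?_)
          exact_mod_cast h0
        have hs : ((Real.sin (π * (y + n)) / (π * (y + n)) : ℝ) : ℂ) =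
            (Complex.exp (-((π * (y + n) : ℝ) : ℂ) * Complex.I) -
              Complex.exp (((π * (y + n) : ℝ) : ℂ) * Complex.I)) * Complex.I / 2 /
              ((π * (y + n) : ℝ) : ℂ) := by
          rw [Complex.ofReal_div, Complex.ofReal_sin, Complex.sin]
        rw [integral_exp_mul_complex hc, Real.sinc_of_ne_zero (mul_ne_zero Real.pi_ne_zero h0), hs]
        have e1 : -(2 * π * Complex.I * ((y + n : ℝ) : ℂ)) * ((1 / 2 : ℝ) : ℂ) =
            -((π * (y + n) : ℝ) : ℂ) * Complex.I := by push_cast; ring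
        have e2 : -(2 * π * Complex.I * ((y + n : ℝ) : ℂ)) * ((-1 / 2 : ℝ) : ℂ) =
            ((π * (y + n) : ℝ) : ℂ) * Complex.I := by push_cast; ring
        rw [e1, e2]
        have h1 : ((π * (y + n) : ℝ) : ℂ) ≠ 0 := by
          exact_mod_cast mul_ne_zero Real.pi_ne_zero h0
        have h2 : -(2 * π * Complex.I * ((y + n : ℝ) : ℂ)) =
            -2 * Complex.I * ((π * (y + n) : ℝ) : ℂ) := by push_cast; ring
        have h3 := Complex.I_ne_zero
        have h4 : (1 / ((1 / 2 : ℝ) - -1 / 2)) = 1 := by norm_num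
        rw [h2, h4, one_smul]
        field_simp
        rw [Complex.I_sq]
        ring
    rw [hcoe, Complex.norm_real, Real.norm_eq_abs, sq_abs]
  simpa only [hco] using h

theorem sin_pi_mul_ne_zero_of_notMem {y : ℝ} (hy : ∀ n : ℤ, y + n ≠ 0) :
    Real.sin (π * y) ≠ 0 := by
  rw [Real.sin_ne_zero_iff]
  intro n h
  apply hy (-n)
  have := Real.pi_ne_zero
  have : π * (y - n) = 0 := by linear_combination -h
  rcases mul_eq_zero.mp this with h | h
  · contradiction
  · push_cast; linarith

/-- The sine in each numerator has the same square for all `n`, so the series is a constant multiple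
of Parseval's series `hasSum_sinc_sq`. For integral `y` only one term is nonzero. -/
theorem hasSum_sinc_sq_fejerKernel (N : ℕ) (y : ℝ) :
    HasSum (fun n : ℤ => Real.sinc (π * ((N + 1) * (y + n))) ^ 2) (fejerKernel N y) := by
  by_cases hy : ∃ n : ℤ, y + n = 0
  · obtain ⟨m, hm⟩ := hy
    have hF : fejerKernel N y = 1 := by
      have : y = 0 - (m : ℝ) * 1 := by linarith
      rw [this, (fejerKernel_periodic N).sub_int_mul_eq, fejerKernel_zero]
    rw [hF]
    convert hasSum_ite_eq m (1 : ℝ) using 2 with n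
    split_ifs with h
    · rw [h, hm]
      simp
    · have : π * (((N : ℝ) + 1) * (y + n)) = π * (((N + 1) * (n - m) : ℤ) : ℝ) := by
        push_cast
        rw [show y = -m by linarith]
        ring
      rw [this, sinc_pi_int]
      · simp
      · exact mul_ne_zero (by omega) (sub_ne_zero.mpr h)
  · push Not at hy
    have hs := sin_pi_mul_ne_zero_of_notMem hy
    have hk := fejerKernel_mul_sin_sq N y
    have hN : (N : ℝ) + 1 ≠ 0 := by positivity
    have e : ∀ n : ℤ, Real.sinc (π * ((N + 1) * (y + n))) ^ 2 =
        fejerKernel N y * Real.sinc (π * (y + n)) ^ 2 := by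
      intro n
      have h1 := sin_pi_mul_add_int_sq (N + 1) y n
      have h2 := sin_pi_mul_add_int_sq 1 y n
      push_cast at h1 h2
      rw [one_mul, mul_one] at h2
      have h3 := hy n
      rw [Real.sinc_of_ne_zero (mul_ne_zero Real.pi_ne_zero (mul_ne_zero hN h3)),
        Real.sinc_of_ne_zero (mul_ne_zero Real.pi_ne_zero h3), div_pow, div_pow, h1, h2, ← hk]
      have := Real.pi_ne_zero
      field_simp
    simp only [e]
    simpa using (hasSum_sinc_sq y).mul_left (fejerKernel N y)

/-- Euler's partial fractions for the cotangent. The series is not absolutely convergent, hence the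
symmetric partial sums. -/
theorem tendsto_sum_one_div_add_int {y : ℝ} (hy : ∀ n : ℤ, y + n ≠ 0) :
    Filter.Tendsto (fun R : ℕ => ∑ n ∈ Finset.Icc (-(R : ℤ)) R, 1 / (y + n)) Filter.atTop
      (nhds (π * (Real.cos (π * y) / Real.sin (π * y)))) := by
  have hz : (y : ℂ) ∈ Complex.integerComplement := by
    rintro ⟨n, hn⟩
    apply hy (-n)
    have : (n : ℝ) = y := by exact_mod_cast hn
    push_cast
    linarith
  have h := (tendsto_logDeriv_euler_cot_sub hz).const_add (1 / (y : ℂ))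
  rw [add_sub_cancel] at h
  have h2 := (Complex.continuous_re.tendsto _).comp h
  have e : (π * Complex.cot (π * y)) =
      ((π * (Real.cos (π * y) / Real.sin (π * y)) : ℝ) : ℂ) := by
    rw [Complex.cot]
    push_cast
    rfl
  rw [e, Complex.ofReal_re] at h2
  refine h2.congr fun R => ?_
  have e2 : (1 / (y : ℂ) + ∑ j ∈ Finset.range R, cotTerm y j) =
      ((∑ n ∈ Finset.Icc (-(R : ℤ)) R, 1 / (y + n) : ℝ) : ℂ) := by
    induction R with
    | zero => simp
    | succ R ih =>
      rw [Finset.sum_range_succ, ← add_assoc, ih, sum_Icc_neg_succ, cotTerm]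
      push_cast
      ring
  simp only [Function.comp, e2, Complex.ofReal_re]

/-- The function `y sinc² (πy)`, which has derivative `1` at `0`. -/
def mulSincSq (y : ℝ) : ℝ := y * Real.sinc (π * y) ^ 2

theorem mulSincSq_int (n : ℤ) : mulSincSq n = 0 := by
  rcases eq_or_ne n 0 with rfl | h
  · simp [mulSincSq]
  · simp [mulSincSq, sinc_pi_int h]

/-- Pulling out the common squared sine leaves the cotangent series, so again only symmetric sums
are controlled. -/
theorem tendsto_sum_mulSincSq (N : ℕ) (y : ℝ) :
    Filter.Tendsto (fun R : ℕ => ∑ n ∈ Finset.Icc (-(R : ℤ)) R, mulSincSq ((N + 1) * (y + n)))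
      Filter.atTop (nhds ((N + 1) * conjFejerKernel N y)) := by
  by_cases hy : ∃ n : ℤ, y + n = 0
  · obtain ⟨m, hm⟩ := hy
    have hF : conjFejerKernel N y = 0 := by
      have : y = 0 - (m : ℝ) * 1 := by linarith
      rw [this, (conjFejerKernel_periodic N).sub_int_mul_eq, conjFejerKernel_zero]
    have e : ∀ n : ℤ, mulSincSq (((N : ℝ) + 1) * (y + n)) = 0 := by
      intro n
      rw [show ((N : ℝ) + 1) * (y + n) = (((N + 1) * (n - m) : ℤ) : ℝ) by
        push_cast
        rw [show y = -m by linarith]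
        ring, mulSincSq_int]
    simp [e, hF]
  · push Not at hy
    have hs := sin_pi_mul_ne_zero_of_notMem hy
    have hk := conjFejerKernel_mul_sin N y
    have hN : (N : ℝ) + 1 ≠ 0 := by positivity
    have hpi := Real.pi_ne_zero
    have e : ∀ n : ℤ, mulSincSq (((N : ℝ) + 1) * (y + n)) =
        Real.sin (π * (N + 1) * y) ^ 2 / (π ^ 2 * (N + 1)) * (1 / (y + n)) := by
      intro n
      have h1 := sin_pi_mul_add_int_sq (N + 1) y n
      push_cast at h1
      have h3 := hy n
      rw [mulSincSq, Real.sinc_of_ne_zero (mul_ne_zero hpi (mul_ne_zero hN h3)), div_pow, h1]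
      field_simp
    simp only [e, ← Finset.mul_sum]
    have h := (tendsto_sum_one_div_add_int hy).const_mul
      (Real.sin (π * (N + 1) * y) ^ 2 / (π ^ 2 * (N + 1)))
    convert h using 2
    generalize Real.sin (π * (N + 1) * y) = s at *
    field_simp
    linear_combination hk

/-! ### Hermite interpolation and quadrature at equally spaced nodes. -/

/-- The exponential `e(nx) = e^{2πinx}`. -/
def expChar (n : ℤ) (x : ℝ) : ℂ := Complex.exp (2 * π * Complex.I * n * x)

theorem fourier_eq_expChar (n : ℤ) (x : ℝ) : fourier n (x : UnitAddCircle) = expChar n x := by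
  rw [fourier_coe_apply, expChar]
  simp

theorem expChar_add_left (m n : ℤ) (x : ℝ) : expChar (m + n) x = expChar m x * expChar n x := by
  rw [expChar, expChar, expChar, ← Complex.exp_add]
  congr 1
  push_cast
  ring

theorem expChar_sub_right (n : ℤ) (x y : ℝ) : expChar n (x - y) = expChar n x * expChar (-n) y := by
  rw [expChar, expChar, expChar, ← Complex.exp_add]
  congr 1
  push_cast
  ring

theorem expChar_zero (x : ℝ) : expChar 0 x = 1 := by
  simp [expChar]

theorem expChar_eq (n : ℤ) (x : ℝ) : expChar n x =
    (Real.cos (2 * π * n * x) : ℂ) + (Real.sin (2 * π * n * x) : ℂ) * Complex.I := by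
  rw [expChar, Complex.ofReal_cos, Complex.ofReal_sin, ← Complex.exp_mul_I]
  congr 1
  push_cast
  ring

theorem hasDerivAt_expChar (n : ℤ) (x : ℝ) :
    HasDerivAt (expChar n) (2 * π * Complex.I * n * expChar n x) x := by
  have h := ((Complex.ofRealCLM.hasDerivAt (x := x)).const_mul (2 * π * Complex.I * n)).cexp
  refine HasDerivAt.congr_deriv h ?_
  simp only [expChar, Complex.ofRealCLM_apply, Complex.ofReal_one]
  ring

theorem sum_Icc_neg_odd {M : Type*} [AddCommGroup M] (N : ℕ) (g : ℤ → M)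
    (hg : ∀ n, g (-n) = -g n) (h0 : g 0 = 0) : ∑ n ∈ Finset.Icc (-(N : ℤ)) N, g n = 0 := by
  induction N with
  | zero => simpa using h0
  | succ N ih => rw [sum_Icc_neg_succ, ih, hg]; simp

theorem fejerKernel_eq_expChar (N : ℕ) (y : ℝ) : (fejerKernel N y : ℂ) =
    1 / ((N : ℂ) + 1) ^ 2 *
      ∑ c ∈ Finset.Icc (-(N : ℤ)) N, ((N : ℂ) + 1 - ((|c| : ℤ) : ℂ)) * expChar c y := by
  have h := sum_Icc_neg_odd N
    (fun c => ((N : ℝ) + 1 - |(c : ℝ)|) * Real.sin (2 * π * c * y)) (fun n => by simp) (by simp)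
  have h' := congrArg Complex.ofReal h
  have ha : ∀ c : ℤ, ((|c| : ℤ) : ℂ) = ((|(c : ℝ)| : ℝ) : ℂ) := by
    intro c
    rw [← Int.cast_abs, Complex.ofReal_intCast]
  rw [fejerKernel]
  simp only [ha, expChar_eq, mul_add, Finset.sum_add_distrib, ← mul_assoc, ← Finset.sum_mul]
  push_cast at h' ⊢
  rw [h', mul_zero, zero_mul, add_zero]

theorem conjFejerKernel_eq_expChar (N : ℕ) (y : ℝ) : (conjFejerKernel N y : ℂ) =
    1 / (2 * π * Complex.I * ((N : ℂ) + 1) ^ 2) *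
      (∑ c ∈ Finset.Icc (-(N : ℤ)) N, ((c.sign : ℤ) : ℂ) * expChar c y +
        (expChar (N + 1) y - expChar (-(N + 1)) y) / 2) := by
  have h := sum_Icc_neg_odd N
    (fun c => (c.sign : ℝ) * Real.cos (2 * π * c * y)) (fun n => by simp) (by simp)
  have h' := congrArg Complex.ofReal h
  rw [conjFejerKernel]
  simp only [expChar_eq, mul_add, Finset.sum_add_distrib, ← mul_assoc, ← Finset.sum_mul]
  push_cast at h' ⊢
  rw [h', show 2 * (π : ℂ) * -((N : ℂ) + 1) * y = -(2 * π * (N + 1) * y) by ring, Complex.cos_neg,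
    Complex.sin_neg]
  have h1 : (π : ℂ) ≠ 0 := by exact_mod_cast Real.pi_ne_zero
  have h2 : (N : ℂ) + 1 ≠ 0 := by exact_mod_cast N.succ_ne_zero
  have h3 := Complex.I_ne_zero
  generalize ∑ x ∈ Finset.Icc (-(N : ℤ)) N, (x.sign : ℂ) * Complex.sin (2 * π * x * y) = A
  field_simp
  ring

/-- The interpolation nodes `(j + a) / (N + 1)`. -/
def interpNode (N : ℕ) (a : ℝ) (j : ℕ) : ℝ := (j + a) / (N + 1)

/-- A geometric sum whose ratio is an `(N+1)`-th root of unity other than `1`. -/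
theorem sum_expChar_interpNode (N : ℕ) (a : ℝ) {m : ℤ} (hm : ¬ ((N + 1 : ℤ) ∣ m)) :
    ∑ j ∈ Finset.range (N + 1), expChar m (interpNode N a j) = 0 := by
  have h2 : (N : ℂ) + 1 ≠ 0 := by exact_mod_cast N.succ_ne_zero
  set ζ := Complex.exp (2 * π * Complex.I * (m / (N + 1))) with hζ
  have e : ∀ j : ℕ, expChar m (interpNode N a j) =
      Complex.exp (2 * π * Complex.I * m * (a / (N + 1))) * ζ ^ j := by
    intro j
    rw [expChar, interpNode, hζ, ← Complex.exp_nat_mul, ← Complex.exp_add]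
    congr 1
    push_cast
    field_simp
    ring
  have hne : ζ ≠ 1 := by
    intro h
    rw [hζ, Complex.exp_eq_one_iff] at h
    obtain ⟨n, hn⟩ := h
    apply hm
    refine ⟨n, ?_⟩
    have h3 := Complex.two_pi_I_ne_zero
    have h4 : (m : ℂ) / (N + 1) = n := by
      have : 2 * π * Complex.I * ((m : ℂ) / (N + 1)) = 2 * π * Complex.I * n := by rw [hn]; ring
      exact mul_left_cancel₀ h3 this
    rw [div_eq_iff h2] at h4
    have : (m : ℂ) = ((n * (N + 1) : ℤ) : ℂ) := by rw [h4]; push_cast; ring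
    rw [mul_comm]
    exact_mod_cast this
  have hpow : ζ ^ (N + 1) = 1 := by
    rw [hζ, ← Complex.exp_nat_mul, Complex.exp_eq_one_iff]
    refine ⟨m, ?_⟩
    push_cast
    field_simp
  simp only [e]
  rw [← Finset.mul_sum, geom_sum_eq hne, hpow, sub_self, zero_div, mul_zero]

theorem sum_expChar_zero_interpNode (N : ℕ) (a : ℝ) :
    ∑ j ∈ Finset.range (N + 1), expChar 0 (interpNode N a j) = N + 1 := by
  simp [expChar_zero]

/-- The interpolation formula holds for exponentials of frequency at most `N`. -/
theorem sum_expChar_mul_kernels (N : ℕ) (a x : ℝ) {k : ℤ} (hk : |k| ≤ N) :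
    ∑ j ∈ Finset.range (N + 1), (expChar k (interpNode N a j) * fejerKernel N (x - interpNode N a j)
      + 2 * π * Complex.I * k * expChar k (interpNode N a j) *
        conjFejerKernel N (x - interpNode N a j)) = expChar k x := by
  have h1 : (π : ℂ) ≠ 0 := by exact_mod_cast Real.pi_ne_zero
  have h2 : (N : ℂ) + 1 ≠ 0 := by exact_mod_cast N.succ_ne_zero
  have h3 := Complex.I_ne_zero
  rw [abs_le] at hk
  -- The derivative factor `2πik` cancels the constant of the conjugate kernel, so both kernels
  -- merge into one exponential sum with weights `N + 1 - |c| + k sign c`.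
  have e1 : ∀ y : ℝ, (fejerKernel N y : ℂ) + 2 * π * Complex.I * k * conjFejerKernel N y =
      1 / ((N : ℂ) + 1) ^ 2 * (∑ c ∈ Finset.Icc (-(N : ℤ)) N,
        ((N : ℂ) + 1 - ((|c| : ℤ) : ℂ) + k * ((c.sign : ℤ) : ℂ)) * expChar c y +
        (k * expChar (N + 1) y - k * expChar (-(N + 1)) y) / 2) := by
    intro y
    rw [fejerKernel_eq_expChar, conjFejerKernel_eq_expChar]
    simp only [add_mul _ ((k : ℂ) * _), Finset.sum_add_distrib, mul_assoc, ← Finset.mul_sum]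
    field_simp
    ring
  have e2 : ∀ (c : ℤ) (w : ℂ), ∑ j ∈ Finset.range (N + 1),
      expChar k (interpNode N a j) * (w * expChar c (x - interpNode N a j)) =
      w * expChar c x * ∑ j ∈ Finset.range (N + 1), expChar (k - c) (interpNode N a j) := by
    intro c w
    rw [Finset.mul_sum]
    refine Finset.sum_congr rfl fun j _ => ?_
    rw [expChar_sub_right, sub_eq_add_neg, expChar_add_left]
    ring
  -- The frequencies `±(N+1)` alias only to `k = 0`, where the weight `k` vanishes.
  have e3 : ∀ c : ℤ, |c| = N + 1 → ∑ j ∈ Finset.range (N + 1),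
      expChar k (interpNode N a j) * (k * expChar c (x - interpNode N a j)) = 0 := by
    intro c hc
    rw [e2]
    rcases eq_or_ne k 0 with rfl | hk0
    · simp
    · rw [sum_expChar_interpNode, mul_zero]
      intro hd
      have hd2 : (N + 1 : ℤ) ∣ c := by rw [← hc]; exact abs_dvd_self c
      have hd3 : (N + 1 : ℤ) ∣ k := by simpa using dvd_add hd hd2
      have := Int.le_of_dvd (abs_pos.mpr hk0) ((dvd_abs _ _).mpr hd3)
      have : |k| ≤ N := abs_le.mpr hk
      omega
  have e4 : ∑ c ∈ Finset.Icc (-(N : ℤ)) N, ∑ j ∈ Finset.range (N + 1),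
      expChar k (interpNode N a j) * (((N : ℂ) + 1 - ((|c| : ℤ) : ℂ) + k * ((c.sign : ℤ) : ℂ)) *
        expChar c (x - interpNode N a j)) = ((N : ℂ) + 1) ^ 2 * expChar k x := by
    simp only [e2]
    rw [Finset.sum_eq_single k]
    · rw [sub_self, sum_expChar_zero_interpNode]
      have : (k : ℂ) * ((k.sign : ℤ) : ℂ) = ((|k| : ℤ) : ℂ) := by
        rw [← Int.cast_mul, Int.mul_sign_self, Int.abs_eq_natAbs]
      rw [this]
      ring
    · intro c hc hck
      rw [Finset.mem_Icc] at hc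
      -- The possible aliases of `k` in the window are `k ± (N+1)`, and there the merged weight is
      -- exactly zero.
      by_cases hd : (N + 1 : ℤ) ∣ k - c
      · have hw : (N : ℤ) + 1 - |c| + k * c.sign = 0 := by
          obtain ⟨t, ht⟩ := hd
          have ht1 : t < 2 := by nlinarith
          have ht2 : -2 < t := by nlinarith
          have ht0 : t ≠ 0 := by rintro rfl; omega
          obtain rfl | rfl : t = 1 ∨ t = -1 := by omega
          · rw [Int.sign_eq_neg_one_of_neg (by omega), abs_of_neg (by omega)]
            omega
          · rw [Int.sign_eq_one_of_pos (by omega), abs_of_pos (by omega)]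
            omega
        have hw' : (N : ℂ) + 1 - ((|c| : ℤ) : ℂ) + k * ((c.sign : ℤ) : ℂ) = 0 := by
          exact_mod_cast congrArg (Int.cast : ℤ → ℂ) hw
        rw [hw']
        simp
      · rw [sum_expChar_interpNode N a hd, mul_zero]
    · intro h
      exact absurd (Finset.mem_Icc.mpr hk) h
  have e5 : ∀ j : ℕ, expChar k (interpNode N a j) * fejerKernel N (x - interpNode N a j)
      + 2 * π * Complex.I * k * expChar k (interpNode N a j) *
        conjFejerKernel N (x - interpNode N a j) =
      1 / ((N : ℂ) + 1) ^ 2 * (∑ c ∈ Finset.Icc (-(N : ℤ)) N, expChar k (interpNode N a j) *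
        (((N : ℂ) + 1 - ((|c| : ℤ) : ℂ) + k * ((c.sign : ℤ) : ℂ)) *
          expChar c (x - interpNode N a j)) +
        (expChar k (interpNode N a j) * (k * expChar (N + 1) (x - interpNode N a j)) -
          expChar k (interpNode N a j) * (k * expChar (-(N + 1)) (x - interpNode N a j))) / 2) := by
    intro j
    rw [← Finset.mul_sum]
    linear_combination expChar k (interpNode N a j) * e1 (x - interpNode N a j)
  simp only [e5]
  rw [← Finset.mul_sum, Finset.sum_add_distrib, Finset.sum_comm, e4, ← Finset.sum_div,
    Finset.sum_sub_distrib, e3 _ (by rw [abs_of_nonneg]; omega),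
    e3 _ (by rw [abs_neg, abs_of_nonneg]; omega)]
  field_simp
  ring

/-- The Hermite interpolation operator at the nodes `(j + a) / (N + 1)`. -/
def hermiteInterp (N : ℕ) (a : ℝ) (v w : ℝ → ℝ) (x : ℝ) : ℝ :=
  ∑ j ∈ Finset.range (N + 1), (v (interpNode N a j) * fejerKernel N (x - interpNode N a j) +
    w (interpNode N a j) * conjFejerKernel N (x - interpNode N a j))

theorem hermiteInterp_congr {N : ℕ} {a : ℝ} {v v' w w' : ℝ → ℝ}
    (hv : ∀ j ∈ Finset.range (N + 1), v (interpNode N a j) = v' (interpNode N a j))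
    (hw : ∀ j ∈ Finset.range (N + 1), w (interpNode N a j) = w' (interpNode N a j)) (x : ℝ) :
    hermiteInterp N a v w x = hermiteInterp N a v' w' x :=
  Finset.sum_congr rfl fun j hj => by rw [hv j hj, hw j hj]

/-- A trigonometric polynomial of degree at most `N` is reproduced by Hermite interpolation. -/
theorem hermiteInterp_eq {N : ℕ} {p : ℝ → ℝ} {c : ℤ → ℂ}
    (hp : ∀ x, (p x : ℂ) = ∑ n ∈ Finset.Icc (-(N : ℤ)) N, c n * expChar n x) (a : ℝ) {p' : ℝ → ℝ}
    (hp' : ∀ j ∈ Finset.range (N + 1),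
      HasDerivAt p (p' (interpNode N a j)) (interpNode N a j)) (x : ℝ) :
    hermiteInterp N a p p' x = p x := by
  have hd : ∀ j ∈ Finset.range (N + 1), (p' (interpNode N a j) : ℂ) = ∑ n ∈ Finset.Icc (-(N : ℤ)) N,
      c n * (2 * π * Complex.I * n * expChar n (interpNode N a j)) := by
    intro j hj
    refine (hp' j hj).ofReal_comp.unique ?_
    have : (fun x => (p x : ℂ)) = fun x => ∑ n ∈ Finset.Icc (-(N : ℤ)) N, c n * expChar n x :=
      funext hp
    rw [this]
    exact HasDerivAt.fun_sum fun n _ => (hasDerivAt_expChar n _).const_mul (c n)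
  have h : (hermiteInterp N a p p' x : ℂ) = p x := by
    rw [hermiteInterp, hp x]
    push_cast
    rw [Finset.sum_congr rfl fun j hj => by rw [hd j hj]]
    simp only [hp, Finset.sum_mul, ← Finset.sum_add_distrib]
    rw [Finset.sum_comm]
    refine Finset.sum_congr rfl fun n hn => ?_
    rw [← sum_expChar_mul_kernels N a x (abs_le.mpr (Finset.mem_Icc.mp hn)), Finset.mul_sum]
    refine Finset.sum_congr rfl fun j _ => ?_
    ring
  exact_mod_cast h

theorem integral_fourier_unitAddCircle (n : ℤ) :
    ∫ x : UnitAddCircle, fourier n x = if n = 0 then 1 else 0 := by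
  have h := fourierCoeff_fourier (T := 1) n
  have h0 := congrFun h 0
  rw [fourierCoeff] at h0
  simp only [neg_zero, fourier_zero, one_smul] at h0
  have hv : (MeasureTheory.volume : MeasureTheory.Measure UnitAddCircle) =
      AddCircle.haarAddCircle := by
    rw [AddCircle.volume_eq_smul_haarAddCircle]; simp
  rw [hv, h0]
  simp [Pi.single_apply, eq_comm]

/-- The quadrature formula for trigonometric polynomials of degree at most `N`. -/
theorem IsRealTrigPoly.integral_eq {N : ℕ} {q : UnitAddCircle → ℝ} (hq : IsRealTrigPoly N q)
    (a : ℝ) : ∫ x : UnitAddCircle, q x =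
      1 / ((N : ℝ) + 1) * ∑ j ∈ Finset.range (N + 1), q (interpNode N a j : ℝ) := by
  obtain ⟨c, hc⟩ := hq
  have h2 : (N : ℂ) + 1 ≠ 0 := by exact_mod_cast N.succ_ne_zero
  have h : ((∫ x : UnitAddCircle, q x : ℝ) : ℂ) =
      ((1 / ((N : ℝ) + 1) * ∑ j ∈ Finset.range (N + 1), q (interpNode N a j : ℝ) : ℝ) : ℂ) := by
    rw [← integral_complex_ofReal]
    push_cast
    simp only [hc]
    rw [MeasureTheory.integral_finsetSum, Finset.sum_comm]
    · simp only [MeasureTheory.integral_const_mul, integral_fourier_unitAddCircle,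
        fourier_eq_expChar, ← Finset.mul_sum]
      rw [Finset.mul_sum]
      refine Finset.sum_congr rfl fun n hn => ?_
      rw [Finset.mem_Icc] at hn
      split_ifs with h0
      · rw [h0, sum_expChar_zero_interpNode]
        field_simp
      · rw [sum_expChar_interpNode]
        · simp
        -- A nonzero frequency of size at most `N` is not a multiple of `N+1`, so its node sum
        -- vanishes.
        · intro hd
          have := Int.le_of_dvd (abs_pos.mpr h0) ((dvd_abs _ _).mpr hd)
          have : |n| ≤ N := abs_le.mpr hn
          omega
    · intro n _
      exact ((map_continuous (fourier n)).const_mul (c n)).integrable_of_hasCompactSupport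
        (HasCompactSupport.of_compactSpace _)
  exact_mod_cast h

/-! ### Periodization of interpolation series. -/

theorem summable_uncurry_of_dominated {f e : ℤ → ℤ → ℝ} {b : ℤ → ℝ}
    (he : ∀ m n, |f m n| ≤ e m n) (hb : ∀ m, HasSum (e m) (b m)) (hs : Summable b) :
    Summable (Function.uncurry f) := by
  have h0 : ∀ m n, 0 ≤ e m n := fun m n => (abs_nonneg _).trans (he m n)
  have h1 : Summable (Function.uncurry e) := by
    refine (summable_prod_of_nonneg fun p => h0 p.1 p.2).mpr ⟨fun m => (hb m).summable, ?_⟩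
    exact hs.congr fun m => ((hb m).tsum_eq).symm
  exact Summable.of_norm_bounded h1 fun p => he p.1 p.2

theorem hasSum_tsum_of_dominated {f e : ℤ → ℤ → ℝ} {g b : ℤ → ℝ}
    (hf : ∀ m, HasSum (f m) (g m)) (he : ∀ m n, |f m n| ≤ e m n) (hb : ∀ m, HasSum (e m) (b m))
    (hs : Summable b) : HasSum (fun n => ∑' m, f m n) (∑' m, g m) := by
  have h := summable_uncurry_of_dominated he hb hs
  have h1 : Summable fun n => ∑' m, f m n := h.prod_symm.prod
  have h2 : ∑' m, g m = ∑' m, ∑' n, f m n := tsum_congr fun m => (hf m).tsum_eq.symm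
  rw [h2, ← h.tsum_comm]
  exact h1.hasSum

theorem fejerKernel_nonneg (N : ℕ) (y : ℝ) : 0 ≤ fejerKernel N y :=
  (hasSum_sinc_sq_fejerKernel N y).nonneg fun _ => sq_nonneg _

theorem fejerKernel_le_one (N : ℕ) (y : ℝ) : fejerKernel N y ≤ 1 := by
  rw [← fejerKernel_zero N, fejerKernel, fejerKernel]
  refine mul_le_mul_of_nonneg_left (Finset.sum_le_sum fun c hc => ?_) (by positivity)
  rw [mul_zero, Real.cos_zero]
  refine mul_le_mul_of_nonneg_left (Real.cos_le_one _) ?_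
  have : |c| ≤ N := abs_le.mpr (Finset.mem_Icc.mp hc)
  have : |(c : ℝ)| ≤ N := by exact_mod_cast this
  linarith

/-- An integer shift changes `u sinc(πu)` only by the sign `(-1)^m`. The difference thus becomes a
product of two sincs, with quadratic instead of linear decay. -/
theorem mulSincSq_sub_int (u : ℝ) (m : ℤ) : mulSincSq (u - m) - mulSincSq u =
    m * ((-1) ^ m * Real.sinc (π * u) * Real.sinc (π * (u - m))) := by
  have h1 := mul_sinc (π * u)
  have h2 := mul_sinc (π * (u - m))
  have hpi := Real.pi_ne_zero
  have e : Real.sin (π * (u - m)) = (-1) ^ m * Real.sin (π * u) := by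
    rw [show π * (u - m) = π * u - m * π by ring, Real.sin_sub_int_mul_pi]
  have hsq : ((-1 : ℝ) ^ m) * (-1) ^ m = 1 := by
    rw [← mul_zpow]; norm_num
  rw [mulSincSq, mulSincSq]
  generalize Real.sinc (π * u) = s at *
  generalize Real.sinc (π * (u - m)) = t at *
  generalize Real.sin (π * u) = z at *
  generalize (-1 : ℝ) ^ m = σ at *
  rw [e] at h2
  have h3 : π * ((u - m) * t) = π * (σ * (u * s)) := by linear_combination h2 - σ * h1
  have h4 := mul_left_cancel₀ hpi h3
  linear_combination t * h4 + σ * s * h4 + u * s ^ 2 * hsq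

theorem abs_mulSincSq_sub_int_le (u : ℝ) (m : ℤ) : |mulSincSq (u - m) - mulSincSq u| ≤
    |(m : ℝ)| * ((Real.sinc (π * (u - m)) ^ 2 + Real.sinc (π * u) ^ 2) / 2) := by
  rw [mulSincSq_sub_int, abs_mul]
  refine mul_le_mul_of_nonneg_left ?_ (abs_nonneg _)
  rw [abs_mul, abs_mul, abs_zpow, abs_neg, abs_one, one_zpow, one_mul]
  nlinarith [sq_nonneg (|Real.sinc (π * u)| - |Real.sinc (π * (u - m))|),
    sq_abs (Real.sinc (π * u)), sq_abs (Real.sinc (π * (u - m)))]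

/-- The periodization of an interpolation series with values `A` and derivatives `B`. -/
theorem hasSum_interpolation_series (N : ℕ) (a x : ℝ) {A B : ℤ → ℝ} (hA : Summable A)
    (hB : Summable B) (hB1 : Summable fun m : ℤ => (m : ℝ) * B m) (hB0 : ∑' m, B m = 0) :
    HasSum (fun n : ℤ => ∑' m : ℤ, A m * Real.sinc (π * ((N + 1) * (x + n) - m - a)) ^ 2 +
        ∑' m : ℤ, B m * mulSincSq ((N + 1) * (x + n) - m - a))
      (∑' m : ℤ, A m * fejerKernel N (x - (m + a) / (N + 1)) +
        ∑' m : ℤ, (N + 1) * (B m * conjFejerKernel N (x - (m + a) / (N + 1)))) := by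
  have hN : (N : ℝ) + 1 ≠ 0 := by positivity
  have hk : ∀ m : ℤ, HasSum (fun n : ℤ => Real.sinc (π * ((N + 1) * (x + n) - m - a)) ^ 2)
      (fejerKernel N (x - (m + a) / (N + 1))) := by
    intro m
    convert hasSum_sinc_sq_fejerKernel N (x - (m + a) / (N + 1)) using 5 with n
    field_simp
    ring
  refine HasSum.add ?_ ?_
  · refine hasSum_tsum_of_dominated (fun m => (hk m).mul_left (A m))
      (e := fun m n => |A m| * Real.sinc (π * ((N + 1) * (x + n) - m - a)) ^ 2)
      (b := fun m => |A m| * fejerKernel N (x - (m + a) / (N + 1)))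
      (fun m n => ?_) (fun m => (hk m).mul_left _) ?_
    · rw [abs_mul, abs_of_nonneg (sq_nonneg (Real.sinc _))]
    · refine Summable.of_nonneg_of_le (fun m => mul_nonneg (abs_nonneg _) (fejerKernel_nonneg _ _))
        (fun m => ?_) hA.abs
      exact mul_le_of_le_one_right (abs_nonneg _) (fejerKernel_le_one _ _)
  · set u : ℤ → ℝ := fun n => (N + 1) * (x + n) - a with hu
    set H : ℤ → ℝ := fun m => conjFejerKernel N (x - (m + a) / (N + 1)) with hH
    have hu1 : ∀ n m : ℤ, ((N : ℝ) + 1) * (x + n) - m - a = u n - m := by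
      intro n m
      simp only [hu]
      ring
    -- The sum of `y sinc²` over `n` need not converge absolutely. Because `∑ B = 0`, subtracting
    -- the unshifted term does not affect the sum over `m`, and it makes the double series
    -- absolutely summable.
    set D : ℤ → ℤ → ℝ := fun m n => B m * (mulSincSq (u n - m) - mulSincSq (u n)) with hD
    have hk' : ∀ m : ℤ, HasSum (fun n : ℤ => Real.sinc (π * (u n - m)) ^ 2)
        (fejerKernel N (x - (m + a) / (N + 1))) := by
      intro m
      simpa only [hu1] using hk m
    have hk0 : HasSum (fun n : ℤ => Real.sinc (π * u n) ^ 2)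
        (fejerKernel N (x - ((0 : ℤ) + a) / (N + 1))) := by
      simpa using hk' 0
    set b : ℤ → ℝ := fun m => |m * B m| * ((fejerKernel N (x - (m + a) / (N + 1)) +
      fejerKernel N (x - ((0 : ℤ) + a) / (N + 1))) / 2) with hb
    have he : ∀ m n, |D m n| ≤ |m * B m| *
        ((Real.sinc (π * (u n - m)) ^ 2 + Real.sinc (π * u n) ^ 2) / 2) := by
      intro m n
      rw [hD, abs_mul, abs_mul]
      calc _ ≤ |B m| * _ :=
            mul_le_mul_of_nonneg_left (abs_mulSincSq_sub_int_le (u n) m) (abs_nonneg _)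
        _ = _ := by ring
    have hbs : ∀ m, HasSum (fun n => |m * B m| *
        ((Real.sinc (π * (u n - m)) ^ 2 + Real.sinc (π * u n) ^ 2) / 2)) (b m) := fun m =>
      (((hk' m).add hk0).div_const 2).mul_left _
    have hbsum : Summable b := by
      refine Summable.of_nonneg_of_le (fun m => ?_) (fun m => ?_) hB1.abs
      · have h1 := fejerKernel_nonneg N (x - (m + a) / (N + 1))
        have h2 := fejerKernel_nonneg N (x - ((0 : ℤ) + a) / (N + 1))
        positivity
      · have h1 := fejerKernel_le_one N (x - (m + a) / (N + 1))
        have h2 := fejerKernel_le_one N (x - ((0 : ℤ) + a) / (N + 1))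
        exact mul_le_of_le_one_right (abs_nonneg _) (by linarith)
    have hDsum := summable_uncurry_of_dominated he hbs hbsum
    have hg : ∀ m, HasSum (D m) (B m * ((N + 1) * H m - (N + 1) * H 0)) := by
      intro m
      -- Summability of `D m` lets its sum be read off from symmetric partial sums, where the
      -- conjugate kernel is available.
      have h1 : Filter.Tendsto (fun R : ℕ => ∑ n ∈ Finset.Icc (-(R : ℤ)) R, D m n) Filter.atTop
          (nhds (∑' n, D m n)) :=
        (hDsum.prod_factor m).hasSum.comp Finset.tendsto_Icc_neg
      have h2 := ((tendsto_sum_mulSincSq N (x - (m + a) / (N + 1))).sub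
        (tendsto_sum_mulSincSq N (x - ((0 : ℤ) + a) / (N + 1)))).const_mul (B m)
      have h3 : ∑' n, D m n = B m * ((N + 1) * H m - (N + 1) * H 0) := by
        refine tendsto_nhds_unique h1 (h2.congr fun R => ?_)
        rw [← Finset.sum_sub_distrib, Finset.mul_sum]
        refine Finset.sum_congr rfl fun n _ => ?_
        simp only [hD, hu]
        congr 3 <;> field_simp <;> push_cast <;> ring
      rw [← h3]
      exact (hDsum.prod_factor m).hasSum
    have hmain := hasSum_tsum_of_dominated hg he hbs hbsum
    have hgs : Summable fun m => B m * ((N + 1) * H m - (N + 1) * H 0) :=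
      hDsum.prod.congr fun m => (hg m).tsum_eq
    have e1 : ∑' m, B m * ((N + 1) * H m - (N + 1) * H 0) = ∑' m, (N + 1) * (B m * H m) := by
      have h1 := hgs.tsum_add (hB.mul_right ((N + 1) * H 0))
      rw [tsum_mul_right, hB0, zero_mul, add_zero] at h1
      rw [← h1]
      exact tsum_congr fun m => by ring
    have e2 : ∀ n, ∑' m, D m n = ∑' m, B m * mulSincSq ((N + 1) * (x + n) - m - a) := by
      intro n
      have h1 := (hDsum.prod_symm.prod_factor n).tsum_add (hB.mul_right (mulSincSq (u n)))
      rw [tsum_mul_right, hB0, zero_mul, add_zero] at h1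
      calc ∑' m, D m n = _ := h1.symm
        _ = _ := tsum_congr fun m => by
          simp only [hu1, hD, Function.uncurry, Prod.swap]
          ring
    rw [e1] at hmain
    simpa only [e2] using hmain

theorem tsum_int_eq_sum_residues (N : ℕ) {φ : ℤ → ℝ} (hφ : Summable φ) :
    ∑' m, φ m = ∑ j ∈ Finset.range (N + 1), ∑' k : ℤ, φ (j + (N + 1) * k) := by
  have h1 : Summable fun p : Fin (N + 1) × ℤ => φ (p.1 + (N + 1) * p.2) := by
    refine (((Equiv.prodComm _ _).trans (Int.divModEquiv (N + 1)).symm).summable_iff.mpr hφ).congr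
      fun p => ?_
    simp [add_comm, mul_comm]
  have h2 := h1.tsum_prod.trans (tsum_fintype _)
  rw [Finset.sum_range, ← h2,
    ← ((Equiv.prodComm _ _).trans (Int.divModEquiv (N + 1)).symm).tsum_eq]
  refine tsum_congr fun p => ?_
  simp [add_comm, mul_comm]

/-! ### The Gaussian interpolation series as a Hermite interpolant. -/

theorem deriv_gaussianFn (lam x : ℝ) :
    deriv (gaussianFn lam) x = -2 * π * lam * x * gaussianFn lam x := by
  have h : HasDerivAt (gaussianFn lam) (gaussianFn lam x * (-π * lam * (2 * x))) x := by
    have h : HasDerivAt (gaussianFn lam) _ x :=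
      (((hasDerivAt_id x).pow 2).const_mul (-π * lam)).exp
    refine h.congr_deriv ?_
    simp [gaussianFn]
  rw [h.deriv]
  ring

theorem gaussianFn_pos (lam x : ℝ) : 0 < gaussianFn lam x := Real.exp_pos _

/-- Half of the decay absorbs the shift: `(m+a)² + a² - m²/2 = (m+2a)²/2`. -/
theorem gaussianFn_int_add_le {lam : ℝ} (hlam : 0 < lam) (a : ℝ) (m : ℤ) :
    gaussianFn lam (m + a) ≤ Real.exp (π * lam * a ^ 2) * thetaWeight (lam / 2) m := by
  rw [gaussianFn, thetaWeight, ← Real.exp_add, Real.exp_le_exp]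
  nlinarith [mul_nonneg (mul_pos Real.pi_pos hlam).le (sq_nonneg ((m : ℝ) + 2 * a))]

theorem summable_gaussianFn_int_add {lam : ℝ} (hlam : 0 < lam) (a : ℝ) :
    Summable fun m : ℤ => gaussianFn lam (m + a) :=
  Summable.of_nonneg_of_le (fun _ => (gaussianFn_pos _ _).le)
    (gaussianFn_int_add_le hlam a) ((summable_thetaWeight (half_pos hlam)).mul_left _)

theorem abs_deriv_gaussianFn_int_add_le {lam : ℝ} (hlam : 0 < lam) (a : ℝ) (m : ℤ) :
    |deriv (gaussianFn lam) (m + a)| ≤ 2 * π * lam * Real.exp (π * lam * a ^ 2) *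
      ((|(m : ℝ)| + |a|) * thetaWeight (lam / 2) m) := by
  have hpi := Real.pi_pos
  have h1 := gaussianFn_int_add_le hlam a m
  have h2 := gaussianFn_pos lam (m + a)
  have h3 : |2 * π * lam| = 2 * π * lam := abs_of_pos (by positivity)
  rw [deriv_gaussianFn, show -2 * π * lam * (m + a) * gaussianFn lam (m + a) =
    -(2 * π * lam * ((m + a) * gaussianFn lam (m + a))) by ring, abs_neg, abs_mul (2 * π * lam),
    h3, abs_mul,
    abs_of_pos h2]
  calc 2 * π * lam * (|(m : ℝ) + a| * gaussianFn lam (m + a))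
      ≤ 2 * π * lam * ((|(m : ℝ)| + |a|) *
        (Real.exp (π * lam * a ^ 2) * thetaWeight (lam / 2) m)) := by
        gcongr
        exact abs_add_le _ _
    _ = _ := by ring

theorem summable_deriv_gaussianFn_int_add {lam : ℝ} (hlam : 0 < lam) (a : ℝ) :
    Summable fun m : ℤ => deriv (gaussianFn lam) (m + a) := by
  refine Summable.of_norm_bounded (Summable.mul_left _ ?_)
    (abs_deriv_gaussianFn_int_add_le hlam a)
  have h1 := summable_pow_mul_thetaWeight (half_pos hlam) 1
  have h0 := summable_thetaWeight (half_pos hlam)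
  refine (h1.add (h0.mul_left |a|)).congr fun m => ?_
  ring

theorem summable_mul_deriv_gaussianFn_int_add {lam : ℝ} (hlam : 0 < lam) (a : ℝ) :
    Summable fun m : ℤ => (m : ℝ) * deriv (gaussianFn lam) (m + a) := by
  have h2 := summable_pow_mul_thetaWeight (half_pos hlam) 2
  have h1 := summable_pow_mul_thetaWeight (half_pos hlam) 1
  refine Summable.of_norm_bounded
    (((h2.add (h1.mul_left |a|)).mul_left (2 * π * lam * Real.exp (π * lam * a ^ 2)))) fun m => ?_
  rw [Real.norm_eq_abs, abs_mul]
  refine (mul_le_mul_of_nonneg_left (abs_deriv_gaussianFn_int_add_le hlam a m)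
    (abs_nonneg _)).trans_eq ?_
  ring

theorem deriv_gaussianFn_neg (lam x : ℝ) :
    deriv (gaussianFn lam) (-x) = -deriv (gaussianFn lam) x := by
  simp [deriv_gaussianFn, gaussianFn]

/-- Odd symmetry: the sum of the derivatives over a symmetric translate of `ℤ` vanishes. -/
theorem tsum_deriv_gaussianFn_eq_zero (lam a : ℝ) {t : ℤ} (ht : (t : ℝ) = 2 * a) :
    ∑' m : ℤ, deriv (gaussianFn lam) (m + a) = 0 := by
  have h := (Equiv.subLeft (-t)).tsum_eq fun m : ℤ => deriv (gaussianFn lam) (m + a)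
  have e : ∀ m : ℤ, deriv (gaussianFn lam) (((Equiv.subLeft (-t)) m : ℤ) + a) =
      -deriv (gaussianFn lam) (m + a) := by
    intro m
    rw [← deriv_gaussianFn_neg]
    congr 1
    simp only [Equiv.subLeft_apply]
    push_cast
    rw [ht]
    ring
  simp only [e, tsum_neg] at h
  linarith

/-- The interpolation series of the Gaussian at the nodes `m + a`. -/
def gaussianInterp (a lam x : ℝ) : ℝ :=
  (∑' m : ℤ, gaussianFn lam (m + a) * Real.sinc (π * (x - m - a)) ^ 2) +
    ∑' n : ℤ, deriv (gaussianFn lam) (n + a) * mulSincSq (x - n - a)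

theorem gaussianM_eq (lam x : ℝ) : gaussianM lam x = gaussianInterp 0 lam x := by
  simp only [gaussianM, gaussianInterp, mulSincSq, add_zero, sub_zero]

theorem gaussianFn_rescale (lam : ℝ) (N : ℕ) (y : ℝ) :
    gaussianFn (((N : ℝ) + 1) ^ (-2 : ℤ) * lam) ((N + 1) * y) = gaussianFn lam y := by
  have h : (N : ℝ) + 1 ≠ 0 := by positivity
  rw [gaussianFn, gaussianFn, zpow_neg, show ((2 : ℤ)) = ((2 : ℕ) : ℤ) from rfl, zpow_natCast]
  congr 1
  field_simp

theorem deriv_gaussianFn_rescale (lam : ℝ) (N : ℕ) (y : ℝ) :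
    (N + 1) * deriv (gaussianFn (((N : ℝ) + 1) ^ (-2 : ℤ) * lam)) ((N + 1) * y) =
      deriv (gaussianFn lam) y := by
  have h : (N : ℝ) + 1 ≠ 0 := by positivity
  rw [deriv_gaussianFn, deriv_gaussianFn, gaussianFn_rescale, zpow_neg,
    show ((2 : ℤ)) = ((2 : ℕ) : ℤ) from rfl, zpow_natCast]
  field_simp

/-- The periodization of the interpolation series is the Hermite interpolant of the periodized
Gaussian. -/
theorem tsum_gaussianInterp {lam : ℝ} (hlam : 0 < lam) (N : ℕ) (a : ℝ) {t : ℤ}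
    (ht : (t : ℝ) = 2 * a) (x : ℝ) :
    ∑' n : ℤ, gaussianInterp a (((N : ℝ) + 1) ^ (-2 : ℤ) * lam) ((N + 1) * (x + n)) =
      hermiteInterp N a (fun y => ∑' k : ℤ, gaussianFn lam (k + y))
        (fun y => ∑' k : ℤ, deriv (gaussianFn lam) (k + y)) x := by
  set μ := ((N : ℝ) + 1) ^ (-2 : ℤ) * lam with hμ
  have hN : (N : ℝ) + 1 ≠ 0 := by positivity
  have hμ0 : 0 < μ := by positivity
  have hA := summable_gaussianFn_int_add hμ0 a
  have hB := summable_deriv_gaussianFn_int_add hμ0 a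
  have h := (hasSum_interpolation_series N a x hA hB
    (summable_mul_deriv_gaussianFn_int_add hμ0 a) (tsum_deriv_gaussianFn_eq_zero μ a ht)).tsum_eq
  -- Points `m + a` with `m` in one residue class modulo `N+1` rescale to integer translates of a
  -- single node. Periodicity takes the kernels out of the sum over `k`.
  have hnode : ∀ (j : ℕ) (k : ℤ), (((j + (N + 1) * k : ℤ) : ℝ) + a) =
      (N + 1) * (k + interpNode N a j) := by
    intro j k
    rw [interpNode]
    push_cast
    field_simp
    ring
  have hnode' : ∀ (j : ℕ) (k : ℤ), x - (((j + (N + 1) * k : ℤ) : ℝ) + a) / (N + 1) =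
      x - interpNode N a j - k * 1 := by
    intro j k
    rw [hnode]
    field_simp
    ring
  have s1 : Summable fun m : ℤ => gaussianFn μ (m + a) *
      fejerKernel N (x - (m + a) / (N + 1)) :=
    Summable.of_nonneg_of_le
      (fun m => mul_nonneg (gaussianFn_pos _ _).le (fejerKernel_nonneg _ _))
      (fun m => mul_le_of_le_one_right (gaussianFn_pos _ _).le (fejerKernel_le_one _ _)) hA
  obtain ⟨C, hC⟩ : ∃ C, ∀ y, |conjFejerKernel N y| ≤ C := by
    refine ⟨|1 / (2 * π * ((N : ℝ) + 1) ^ 2)| *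
      (∑ c ∈ Finset.Icc (-(N : ℤ)) N, |(c.sign : ℝ)| + 1), fun y => ?_⟩
    rw [conjFejerKernel, abs_mul]
    gcongr
    refine (abs_add_le _ _).trans (add_le_add ((Finset.abs_sum_le_sum_abs _ _).trans
      (Finset.sum_le_sum fun c _ => ?_)) (Real.abs_sin_le_one _))
    rw [abs_mul]
    exact mul_le_of_le_one_right (abs_nonneg _) (Real.abs_sin_le_one _)
  have s2 : Summable fun m : ℤ => ((N : ℝ) + 1) * (deriv (gaussianFn μ) (m + a) *
      conjFejerKernel N (x - (m + a) / (N + 1))) := by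
    refine Summable.mul_left _ (Summable.of_norm_bounded (hB.abs.mul_right C) fun m => ?_)
    rw [Real.norm_eq_abs, abs_mul]
    exact mul_le_mul_of_nonneg_left (hC _) (abs_nonneg _)
  rw [tsum_int_eq_sum_residues N s1, tsum_int_eq_sum_residues N s2,
    ← Finset.sum_add_distrib] at h
  unfold gaussianInterp
  rw [h, hermiteInterp]
  refine Finset.sum_congr rfl fun j _ => ?_
  rw [← tsum_mul_right, ← tsum_mul_right]
  congr 1 <;> refine tsum_congr fun k => ?_
  · rw [hnode', (fejerKernel_periodic N).sub_int_mul_eq, hnode, hμ, gaussianFn_rescale]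
  · rw [hnode', (conjFejerKernel_periodic N).sub_int_mul_eq, hnode, hμ, ← mul_assoc,
      deriv_gaussianFn_rescale]

/-! ### Theta functions as cosine series, and Poisson summation. -/

theorem jacobiTheta₂_term_mul_I (T x : ℝ) (n : ℤ) :
    jacobiTheta₂_term n x (Complex.I * T) =
      (thetaWeight T n : ℂ) * ((Real.cos (2 * π * n * x) : ℂ) +
        (Real.sin (2 * π * n * x) : ℂ) * Complex.I) := by
  rw [jacobiTheta₂_term, thetaWeight, Complex.ofReal_exp, Complex.ofReal_cos, Complex.ofReal_sin,
    ← Complex.exp_mul_I, ← Complex.exp_add]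
  congr 1
  push_cast
  linear_combination (π * (n : ℂ) ^ 2 * T) * Complex.I_sq

theorem jacobiTheta₂_re_eq_cosSeries {T : ℝ} (hT : 0 < T) (x : ℝ) :
    (jacobiTheta₂ x (Complex.I * T)).re = cosSeries (thetaWeight T) x := by
  have him : 0 < (Complex.I * T : ℂ).im := by simpa using hT
  have h := Complex.hasSum_re (hasSum_jacobiTheta₂_term x him)
  rw [← h.tsum_eq, cosSeries]
  refine tsum_congr fun n => ?_
  rw [jacobiTheta₂_term_mul_I, Complex.re_ofReal_mul]
  simp only [Complex.add_re, Complex.ofReal_re, Complex.re_ofReal_mul, Complex.I_re, mul_zero,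
    add_zero]

theorem jacobiTheta₂'_re_eq_cosSeriesDeriv {T : ℝ} (hT : 0 < T) (x : ℝ) :
    (jacobiTheta₂' x (Complex.I * T)).re = cosSeriesDeriv (thetaWeight T) x := by
  have him : 0 < (Complex.I * T : ℂ).im := by simpa using hT
  have h := Complex.hasSum_re (hasSum_jacobiTheta₂'_term x him)
  rw [← h.tsum_eq, cosSeriesDeriv]
  refine tsum_congr fun n => ?_
  have e : jacobiTheta₂'_term n x (Complex.I * T) =
      ((thetaWeight T n * (2 * π * n) : ℝ) : ℂ) * (-(Real.sin (2 * π * n * x) : ℂ) +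
        (Real.cos (2 * π * n * x) : ℂ) * Complex.I) := by
    rw [jacobiTheta₂'_term, jacobiTheta₂_term_mul_I]
    push_cast
    linear_combination (2 * π * n * (thetaWeight T n : ℂ) *
      Complex.sin (2 * π * n * x)) * Complex.I_sq
  rw [e, Complex.re_ofReal_mul]
  simp only [Complex.add_re, Complex.neg_re, Complex.ofReal_re, Complex.re_ofReal_mul,
    Complex.I_re, mul_zero, add_zero]
  ring

theorem neg_I_mul_I_mul_cpow {lam : ℝ} (hlam : 0 < lam) :
    1 / (-Complex.I * (Complex.I * ((lam⁻¹ : ℝ) : ℂ))) ^ (1 / 2 : ℂ) = ((√lam : ℝ) : ℂ) := by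
  rw [show -Complex.I * (Complex.I * ((lam⁻¹ : ℝ) : ℂ)) = ((lam⁻¹ : ℝ) : ℂ) by
    linear_combination -((lam⁻¹ : ℝ) : ℂ) * Complex.I_sq,
    show (1 / 2 : ℂ) = ((1 / 2 : ℝ) : ℂ) by push_cast; rfl,
    ← Complex.ofReal_cpow (inv_pos.mpr hlam).le, ← Real.sqrt_eq_rpow, Real.sqrt_inv]
  push_cast
  simp

/-- Completing the square: the exponential prefactor of the functional equation turns each term of
the dual theta series into a translated Gaussian. -/
theorem cexp_mul_jacobiTheta₂_term {lam : ℝ} (hlam : 0 < lam) (y : ℝ) (n : ℤ) :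
    Complex.exp (-π * Complex.I * y ^ 2 / (Complex.I * ((lam⁻¹ : ℝ) : ℂ))) *
      jacobiTheta₂_term n (y / (Complex.I * ((lam⁻¹ : ℝ) : ℂ)))
        (-1 / (Complex.I * ((lam⁻¹ : ℝ) : ℂ))) = (gaussianFn lam (-n + y) : ℂ) := by
  have h1 : (lam : ℂ) ≠ 0 := by exact_mod_cast hlam.ne'
  have h3 := Complex.I_ne_zero
  rw [jacobiTheta₂_term, gaussianFn, ← Complex.exp_add, Complex.ofReal_exp]
  congr 1
  push_cast
  field_simp
  ring

/-- Poisson summation for the Gaussian. -/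
theorem sqrt_mul_tsum_gaussianFn {lam : ℝ} (hlam : 0 < lam) (y : ℝ) :
    √lam * ∑' k : ℤ, gaussianFn lam (k + y) = cosSeries (thetaWeight lam⁻¹) y := by
  rw [← jacobiTheta₂_re_eq_cosSeries (inv_pos.mpr hlam), jacobiTheta₂_functional_equation,
    neg_I_mul_I_mul_cpow hlam, mul_assoc, Complex.re_ofReal_mul]
  congr 1
  rw [jacobiTheta₂, ← tsum_mul_left]
  simp only [cexp_mul_jacobiTheta₂_term hlam]
  rw [← Complex.ofReal_tsum, Complex.ofReal_re, ← (Equiv.neg ℤ).tsum_eq]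
  simp

/-- Poisson summation for the derivative of the Gaussian. -/
theorem sqrt_mul_tsum_deriv_gaussianFn {lam : ℝ} (hlam : 0 < lam) (y : ℝ) :
    √lam * ∑' k : ℤ, deriv (gaussianFn lam) (k + y) = cosSeriesDeriv (thetaWeight lam⁻¹) y := by
  have him : 0 < (-1 / (Complex.I * ((lam⁻¹ : ℝ) : ℂ))).im := by
    have : -1 / (Complex.I * ((lam⁻¹ : ℝ) : ℂ)) = Complex.I * lam := by
      have h1 : (lam : ℂ) ≠ 0 := by exact_mod_cast hlam.ne'
      have h3 := Complex.I_ne_zero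
      push_cast
      field_simp
      linear_combination -Complex.I_sq
    rw [this]
    simpa using hlam
  have s1 := (hasSum_jacobiTheta₂_term (y / (Complex.I * ((lam⁻¹ : ℝ) : ℂ))) him).summable
  have s2 := (hasSum_jacobiTheta₂'_term (y / (Complex.I * ((lam⁻¹ : ℝ) : ℂ))) him).summable
  have e : ∀ n : ℤ, Complex.exp (-π * Complex.I * y ^ 2 / (Complex.I * ((lam⁻¹ : ℝ) : ℂ))) /
      (Complex.I * ((lam⁻¹ : ℝ) : ℂ)) *
      (jacobiTheta₂'_term n (y / (Complex.I * ((lam⁻¹ : ℝ) : ℂ)))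
        (-1 / (Complex.I * ((lam⁻¹ : ℝ) : ℂ))) - 2 * π * Complex.I * y *
      jacobiTheta₂_term n (y / (Complex.I * ((lam⁻¹ : ℝ) : ℂ)))
        (-1 / (Complex.I * ((lam⁻¹ : ℝ) : ℂ)))) =
        ((deriv (gaussianFn lam) (-n + y) : ℝ) : ℂ) := by
    intro n
    have h := cexp_mul_jacobiTheta₂_term hlam y n
    have h1 : (lam : ℂ) ≠ 0 := by exact_mod_cast hlam.ne'
    have h3 := Complex.I_ne_zero
    rw [deriv_gaussianFn]
    push_cast
    push_cast at h
    rw [jacobiTheta₂'_term, ← h]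
    field_simp
    ring
  rw [← jacobiTheta₂'_re_eq_cosSeriesDeriv (inv_pos.mpr hlam), jacobiTheta₂'_functional_equation,
    neg_I_mul_I_mul_cpow hlam, mul_div_assoc, mul_assoc, Complex.re_ofReal_mul]
  congr 1
  rw [jacobiTheta₂, jacobiTheta₂', ← tsum_mul_left (a := 2 * π * Complex.I * (y : ℂ)),
    ← s2.tsum_sub (s1.mul_left _), ← tsum_mul_left]
  simp only [e]
  rw [← Complex.ofReal_tsum, Complex.ofReal_re, ← (Equiv.neg ℤ).tsum_eq]
  simp

/-! ### From finite products to theta. -/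

theorem cosPoly_eq_expChar (N : ℕ) (u : ℤ → ℝ) (x : ℝ) : (cosPoly N u x : ℂ) =
    ∑ n ∈ Finset.Icc (-(N : ℤ)) N, (((u n + u (-n)) / 2 : ℝ) : ℂ) * expChar n x := by
  have h1 := congrArg Complex.ofReal (sum_Icc_neg_odd N
    (fun n => (u (-n) - u n) / 2 * Real.cos (2 * π * n * x)) (fun n => by simp; ring) (by simp))
  have h2 := congrArg Complex.ofReal (sum_Icc_neg_odd N
    (fun n => (u n + u (-n)) / 2 * Real.sin (2 * π * n * x)) (fun n => by
      push_cast
      rw [mul_neg, neg_mul, Real.sin_neg, neg_neg]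
      ring) (by simp))
  have e : ∀ n : ℤ, (((u n + u (-n)) / 2 : ℝ) : ℂ) * expChar n x =
      ((u n * Real.cos (2 * π * n * x) : ℝ) : ℂ) +
      (((u (-n) - u n) / 2 * Real.cos (2 * π * n * x) : ℝ) : ℂ) +
      (((u n + u (-n)) / 2 * Real.sin (2 * π * n * x) : ℝ) : ℂ) * Complex.I := by
    intro n
    rw [expChar_eq]
    push_cast
    ring
  simp only [e, Finset.sum_add_distrib, ← Finset.sum_mul]
  rw [← Complex.ofReal_sum, ← Complex.ofReal_sum, ← Complex.ofReal_sum, h1, h2]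
  simp [cosPoly]

theorem differentiable_cosPoly (N : ℕ) (u : ℤ → ℝ) : Differentiable ℝ (cosPoly N u) := by
  unfold cosPoly
  fun_prop

/-- A finite-dimensional subspace is closed, here for the topology of pointwise convergence. Limits
of interpolants therefore remain cosine polynomials without any control of coefficients. -/
theorem isClosed_range_cosPoly (N : ℕ) : IsClosed (Set.range (cosPoly N)) := by
  let L : (Finset.Icc (-(N : ℤ)) N → ℝ) →ₗ[ℝ] (ℝ → ℝ) :=
    { toFun := fun w x => ∑ n, w n * Real.cos (2 * π * ((n : ℤ) : ℝ) * x)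
      map_add' := fun w w' => by
        ext x
        simp [add_mul, Finset.sum_add_distrib]
      map_smul' := fun c w => by
        ext x
        simp [mul_assoc, Finset.mul_sum] }
  have h : Set.range (cosPoly N) = (LinearMap.range L : Set (ℝ → ℝ)) := by
    ext p
    constructor
    · rintro ⟨u, rfl⟩
      refine ⟨fun n => u n, ?_⟩
      ext x
      exact Finset.sum_coe_sort (Finset.Icc (-(N : ℤ)) N)
        (fun n : ℤ => u n * Real.cos (2 * π * n * x))
    · rintro ⟨w, rfl⟩
      refine ⟨fun n => if h : n ∈ Finset.Icc (-(N : ℤ)) N then w ⟨n, h⟩ else 0, ?_⟩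
      ext x
      rw [cosPoly, ← Finset.sum_coe_sort]
      refine Finset.sum_congr rfl fun n _ => ?_
      rw [dif_pos n.2]
  rw [h]
  exact Submodule.closed_of_finiteDimensional _

theorem hermiteInterp_const_mul (N : ℕ) (a C : ℝ) (v w : ℝ → ℝ) (x : ℝ) :
    hermiteInterp N a (fun y => C * v y) (fun y => C * w y) x = C * hermiteInterp N a v w x := by
  rw [hermiteInterp, hermiteInterp, Finset.mul_sum]
  exact Finset.sum_congr rfl fun j _ => by ring

theorem tendsto_hermiteInterp {N : ℕ} {a : ℝ} {v w : ℕ → ℝ → ℝ} {v' w' : ℝ → ℝ}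
    (hv : ∀ x, Filter.Tendsto (fun K => v K x) Filter.atTop (nhds (v' x)))
    (hw : ∀ x, Filter.Tendsto (fun K => w K x) Filter.atTop (nhds (w' x))) (x : ℝ) :
    Filter.Tendsto (fun K => hermiteInterp N a (v K) (w K) x) Filter.atTop
      (nhds (hermiteInterp N a v' w' x)) :=
  tendsto_finsetSum _ fun _ _ => ((hv _).mul_const _).add ((hw _).mul_const _)

/-- A function with a nonnegative deviation from a trigonometric polynomial that vanishes at the
nodes has that polynomial as its Hermite interpolant. -/
theorem hermiteInterp_eq_of_touching {N : ℕ} {p : ℝ → ℝ} {c : ℤ → ℂ}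
    (hp : ∀ x, (p x : ℂ) = ∑ n ∈ Finset.Icc (-(N : ℤ)) N, c n * expChar n x)
    (hpd : Differentiable ℝ p) {a ε : ℝ} (hε : ε ^ 2 = 1) {g g' : ℝ → ℝ}
    (hg : ∀ x, HasDerivAt g (g' x) x) (hle : ∀ x, 0 ≤ ε * (p x - g x))
    (hnode : ∀ j ∈ Finset.range (N + 1), p (interpNode N a j) = g (interpNode N a j)) (x : ℝ) :
    hermiteInterp N a g g' x = p x := by
  rw [hermiteInterp_congr (v' := p) (w' := g') (fun j hj => (hnode j hj).symm) fun _ _ => rfl]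
  refine hermiteInterp_eq hp a (fun j hj => ?_) x
  set y := interpNode N a j
  have hd : HasDerivAt (fun x => ε * (p x - g x)) (ε * (deriv p y - g' y)) y :=
    ((hpd y).hasDerivAt.sub (hg y)).const_mul ε
  -- The deviation is nonnegative and zero at the node, so its derivative vanishes there.
  have hmin : IsLocalMin (fun x => ε * (p x - g x)) y :=
    Filter.Eventually.of_forall fun x => by
      beta_reduce
      rw [hnode j hj, sub_self, mul_zero]
      exact hle x
  have h0 := hmin.hasDerivAt_eq_zero hd
  have hε0 : ε ≠ 0 := by rintro rfl; norm_num at hε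
  have h1 : deriv p y = g' y := sub_eq_zero.mp ((mul_eq_zero.mp h0).resolve_left hε0)
  rw [← h1]
  exact (hpd y).hasDerivAt

theorem cos_interpNode (N : ℕ) (a : ℝ) (j : ℕ) :
    Real.cos (2 * π * (N + 1) * interpNode N a j) = Real.cos (2 * π * a) := by
  have hN : (N : ℝ) + 1 ≠ 0 := by positivity
  rw [interpNode, show 2 * π * ((N : ℝ) + 1) * ((j + a) / (N + 1)) = 2 * π * a + j * (2 * π) by
    field_simp
    ring, Real.cos_add_nat_mul_two_pi]

/-- The interpolant of a finite Jacobi product. -/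
theorem hermiteInterp_thetaApprox {N : ℕ} {a ε T : ℝ} (hT : 0 < T) (hε : ε ^ 2 = 1)
    (ha : Real.cos (2 * π * a) = ε) {K : ℕ} {u : ℤ → ℝ} {S : ℝ → ℝ}
    (h : Decomposes N ε (thetaProd (fun i => Real.exp (-π * T) ^ (2 * i + 1)) K) u S) :
    (∀ x, 0 ≤ ε * (hermiteInterp N a (cosSeries (thetaApproxCoeff T K))
        (cosSeriesDeriv (thetaApproxCoeff T K)) x - cosSeries (thetaApproxCoeff T K) x)) ∧
      (∀ j, hermiteInterp N a (cosSeries (thetaApproxCoeff T K))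
        (cosSeriesDeriv (thetaApproxCoeff T K)) (interpNode N a j) =
          cosSeries (thetaApproxCoeff T K) (interpNode N a j)) ∧
      hermiteInterp N a (cosSeries (thetaApproxCoeff T K))
        (cosSeriesDeriv (thetaApproxCoeff T K)) ∈ Set.range (cosPoly N) := by
  obtain ⟨C, hC, hprod⟩ := exists_thetaProd_eq hT K
  obtain ⟨-, -, -, hS, hdec⟩ := h
  set g := cosSeries (thetaApproxCoeff T K)
  set g' := cosSeriesDeriv (thetaApproxCoeff T K)
  have hdiff : ∀ x, cosPoly N u x - C * g x =
      ε * (2 - 2 * ε * Real.cos (2 * π * (N + 1) * x)) * S x := by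
    intro x
    linear_combination hprod x - hdec x
  -- From `(ε - cos)² ≥ 0`, `ε² = 1` and `cos² ≤ 1`.
  have hW : ∀ x, 0 ≤ 2 - 2 * ε * Real.cos (2 * π * (N + 1) * x) := by
    intro x
    nlinarith [sq_nonneg (ε - Real.cos (2 * π * (N + 1) * x)),
      Real.cos_sq_le_one (2 * π * (N + 1) * x)]
  have hle : ∀ x, 0 ≤ ε * (cosPoly N u x - C * g x) := by
    intro x
    rw [hdiff, ← mul_assoc, ← mul_assoc, ← sq, hε, one_mul]
    exact mul_nonneg (hW x) (hS x)
  have hnode : ∀ j, cosPoly N u (interpNode N a j) = C * g (interpNode N a j) := by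
    intro j
    have := hdiff (interpNode N a j)
    rw [cos_interpNode, ha] at this
    linear_combination this - 2 * ε * S (interpNode N a j) * hε
  have hI : ∀ x, C * hermiteInterp N a g g' x = cosPoly N u x := by
    intro x
    rw [← hermiteInterp_const_mul]
    exact hermiteInterp_eq_of_touching (cosPoly_eq_expChar N u) (differentiable_cosPoly N u) hε
      (fun x => (hasDerivAt_cosSeries hT (abs_thetaApproxCoeff_le hT K) x).const_mul C) hle
      (fun j _ => hnode j) x
  refine ⟨fun x => ?_, fun j => ?_, fun n => C⁻¹ * u n, ?_⟩
  · have h1 := hle x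
    rw [← hI, ← mul_sub, mul_left_comm] at h1
    exact nonneg_of_mul_nonneg_right h1 hC
  · exact mul_left_cancel₀ hC.ne' ((hI _).trans (hnode j))
  · ext x
    have h1 := hI x
    rw [cosPoly] at h1
    simp only [cosPoly, mul_assoc C⁻¹, ← Finset.mul_sum]
    rw [← h1, inv_mul_cancel_left₀ hC.ne']

/-- The Hermite interpolant of the theta function. -/
theorem hermiteInterp_theta {N : ℕ} {a ε T : ℝ} (hT : 0 < T) (hε : ε ^ 2 = 1)
    (ha : Real.cos (2 * π * a) = ε)
    (h : ∀ K, ∃ u S, Decomposes N ε (thetaProd (fun i => Real.exp (-π * T) ^ (2 * i + 1)) K) u S) :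
    (∀ x, 0 ≤ ε * (hermiteInterp N a (cosSeries (thetaWeight T)) (cosSeriesDeriv (thetaWeight T)) x
        - cosSeries (thetaWeight T) x)) ∧
      (∀ j, hermiteInterp N a (cosSeries (thetaWeight T)) (cosSeriesDeriv (thetaWeight T))
        (interpNode N a j) = cosSeries (thetaWeight T) (interpNode N a j)) ∧
      ∃ u, ∀ x, hermiteInterp N a (cosSeries (thetaWeight T)) (cosSeriesDeriv (thetaWeight T)) x =
        cosPoly N u x := by
  choose u S hu using h
  have hK := fun K => hermiteInterp_thetaApprox hT hε ha (hu K)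
  have h0 := tendsto_cosSeries hT (abs_thetaApproxCoeff_le hT) (tendsto_thetaApproxCoeff hT)
  have h1 := tendsto_cosSeriesDeriv hT (abs_thetaApproxCoeff_le hT) (tendsto_thetaApproxCoeff hT)
  -- No convergence of the decompositions `u K`, `S K` is needed. The interpolants converge because
  -- they depend on finitely many values and derivatives.
  have h2 := tendsto_hermiteInterp (N := N) (a := a) h0 h1
  refine ⟨fun x => ?_, fun j => ?_, ?_⟩
  · exact ge_of_tendsto' (((h2 x).sub (h0 x)).const_mul ε) fun K => (hK K).1 x
  · exact tendsto_nhds_unique ((h2 _).congr fun K => (hK K).2.1 j) (h0 _)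
  · obtain ⟨u, hu⟩ := (isClosed_range_cosPoly N).mem_of_tendsto (tendsto_pi_nhds.mpr h2)
      (Filter.Eventually.of_forall fun K => (hK K).2.2)
    exact ⟨u, fun x => (congrFun hu x).symm⟩

/-! ### Identification of the extremal functions, and extremality. -/

/-- The mean value of the theta function over the nodes. -/
theorem sum_theta_interpNode {lam : ℝ} (hlam : 0 < lam) (N : ℕ) (a : ℝ) :
    1 / ((N : ℝ) + 1) * ∑ j ∈ Finset.range (N + 1),
      cosSeries (thetaWeight lam⁻¹) (interpNode N a j) =
        cosSeries (thetaWeight (lam⁻¹ * ((N : ℝ) + 1) ^ 2)) a := by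
  set μ := ((N : ℝ) + 1) ^ (-2 : ℤ) * lam with hμ
  have hN : (N : ℝ) + 1 ≠ 0 := by positivity
  have hμ0 : 0 < μ := by positivity
  have hinv : lam⁻¹ * ((N : ℝ) + 1) ^ 2 = μ⁻¹ := by
    rw [hμ, mul_inv, zpow_neg, inv_inv, mul_comm]
    rfl
  have hsqrt : √μ = 1 / ((N : ℝ) + 1) * √lam := by
    rw [hμ, Real.sqrt_mul (by positivity), zpow_neg, Real.sqrt_inv,
      show ((2 : ℤ)) = ((2 : ℕ) : ℤ) from rfl, zpow_natCast, Real.sqrt_sq (by positivity), one_div]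
  rw [hinv, ← sqrt_mul_tsum_gaussianFn hμ0,
    tsum_int_eq_sum_residues N (summable_gaussianFn_int_add hμ0 a), hsqrt, mul_assoc]
  simp only [← sqrt_mul_tsum_gaussianFn hlam, ← Finset.mul_sum]
  congr 2
  refine Finset.sum_congr rfl fun j _ => tsum_congr fun k => ?_
  rw [← gaussianFn_rescale lam N, ← hμ]
  congr 1
  rw [interpNode]
  push_cast
  field_simp
  ring

theorem theta3_re_eq_cosSeries {T : ℝ} (hT : 0 < T) (x : ℝ) :
    (theta3 x (Complex.I * T)).re = cosSeries (thetaWeight T) x := by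
  rw [theta3_eq_jacobiTheta₂, jacobiTheta₂_re_eq_cosSeries hT]

theorem theta2_zero_eq_theta3 (τ : ℂ) : theta2 0 τ = theta3 ((1 / 2 : ℝ) : ℂ) τ := by
  unfold theta2 theta3
  refine tsum_congr fun n => ?_
  have e : Complex.exp (2 * π * Complex.I * (n * ((1 / 2 : ℝ) : ℂ))) = (-1 : ℂ) ^ n := by
    rw [← Complex.exp_pi_mul_I, ← Complex.exp_int_mul]
    congr 1
    push_cast
    ring
  rw [e]
  simp [mul_comm]

theorem sqrt_mul_tsum_gaussianInterp {lam : ℝ} (hlam : 0 < lam) (N : ℕ) (a : ℝ) {t : ℤ}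
    (ht : (t : ℝ) = 2 * a) (x : ℝ) :
    √lam * ∑' n : ℤ, gaussianInterp a (((N : ℝ) + 1) ^ (-2 : ℤ) * lam) ((N + 1) * (x + n)) =
      hermiteInterp N a (cosSeries (thetaWeight lam⁻¹)) (cosSeriesDeriv (thetaWeight lam⁻¹)) x := by
  rw [tsum_gaussianInterp hlam N a ht, ← hermiteInterp_const_mul]
  simp only [sqrt_mul_tsum_gaussianFn hlam, sqrt_mul_tsum_deriv_gaussianFn hlam]

theorem thetaMinorant_coe {lam : ℝ} (hlam : 0 < lam) (N : ℕ) (x : ℝ) :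
    thetaMinorant lam N (x : UnitAddCircle) = hermiteInterp N (1 / 2)
      (cosSeries (thetaWeight lam⁻¹)) (cosSeriesDeriv (thetaWeight lam⁻¹)) x := by
  rw [← sqrt_mul_tsum_gaussianInterp hlam N (1 / 2) (t := 1) (by norm_num)]
  -- `gaussianL` agrees by definition with `gaussianInterp (1 / 2)`.
  exact Function.Periodic.lift_coe _ x

theorem thetaMajorant_coe {lam : ℝ} (hlam : 0 < lam) (N : ℕ) (x : ℝ) :
    thetaMajorant lam N (x : UnitAddCircle) = hermiteInterp N 0
      (cosSeries (thetaWeight lam⁻¹)) (cosSeriesDeriv (thetaWeight lam⁻¹)) x := by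
  rw [← sqrt_mul_tsum_gaussianInterp hlam N 0 (t := 0) (by norm_num)]
  simp only [← gaussianM_eq]
  exact Function.Periodic.lift_coe _ x

theorem isRealTrigPoly_of_eq_cosPoly {N : ℕ} {q : UnitAddCircle → ℝ} {u : ℤ → ℝ}
    (h : ∀ x : ℝ, q x = cosPoly N u x) : IsRealTrigPoly N q := by
  refine ⟨fun n => (((u n + u (-n)) / 2 : ℝ) : ℂ), fun x => ?_⟩
  induction x using QuotientAddGroup.induction_on with
  | H x =>
    change ((q (x : UnitAddCircle) : ℝ) : ℂ) = ∑ n ∈ Finset.Icc (-(N : ℤ)) N,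
      (((u n + u (-n)) / 2 : ℝ) : ℂ) * fourier n (x : UnitAddCircle)
    simp only [fourier_eq_expChar]
    rw [h, cosPoly_eq_expChar]

theorem differentiable_of_eq_sum_expChar {N : ℕ} {p : ℝ → ℝ} {c : ℤ → ℂ}
    (hp : ∀ x, (p x : ℂ) = ∑ n ∈ Finset.Icc (-(N : ℤ)) N, c n * expChar n x) :
    Differentiable ℝ p := by
  have h : p = fun x => Complex.reCLM (∑ n ∈ Finset.Icc (-(N : ℤ)) N, c n * expChar n x) := by
    ext x
    rw [← hp]
    rfl
  rw [h]
  refine Complex.reCLM.differentiable.comp (Differentiable.fun_sum fun n _ => ?_)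
  exact fun x => ((hasDerivAt_expChar n x).const_mul (c n)).differentiableAt

/-- The extremal property of the Hermite interpolant `m` of the theta function. -/
theorem extremal_of_hermiteInterp {lam : ℝ} (hlam : 0 < lam) {N : ℕ} {a ε : ℝ} (hε : ε ^ 2 = 1)
    {m : UnitAddCircle → ℝ} (hm : ∀ x : ℝ, m x = hermiteInterp N a
      (cosSeries (thetaWeight lam⁻¹)) (cosSeriesDeriv (thetaWeight lam⁻¹)) x)
    (hmnode : ∀ j, m (interpNode N a j : ℝ) =
      cosSeries (thetaWeight lam⁻¹) (interpNode N a j))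
    {q : UnitAddCircle → ℝ} (hq : IsRealTrigPoly N q)
    (hle : ∀ x : ℝ, 0 ≤ ε * (q x - cosSeries (thetaWeight lam⁻¹) x)) :
    0 ≤ ε * ((∫ x : UnitAddCircle, q x) -
        cosSeries (thetaWeight (lam⁻¹ * ((N : ℝ) + 1) ^ 2)) a) ∧
      ((∫ x : UnitAddCircle, q x) = cosSeries (thetaWeight (lam⁻¹ * ((N : ℝ) + 1) ^ 2)) a ↔
        q = m) := by
  have hN : (0 : ℝ) < 1 / ((N : ℝ) + 1) := by positivity
  have hε0 : ε ≠ 0 := by rintro rfl; norm_num at hε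
  set f := cosSeries (thetaWeight lam⁻¹)
  have hkey : ε * ((∫ x : UnitAddCircle, q x) -
      cosSeries (thetaWeight (lam⁻¹ * ((N : ℝ) + 1) ^ 2)) a) = 1 / ((N : ℝ) + 1) *
        ∑ j ∈ Finset.range (N + 1), ε * (q (interpNode N a j : ℝ) - f (interpNode N a j)) := by
    rw [hq.integral_eq a, ← sum_theta_interpNode hlam, ← mul_sub, ← Finset.sum_sub_distrib,
      ← Finset.mul_sum]
    ring
  have hnn : ∀ j ∈ Finset.range (N + 1),
      0 ≤ ε * (q (interpNode N a j : ℝ) - f (interpNode N a j)) := fun j _ => hle _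
  refine ⟨?_, fun h => ?_, fun h => ?_⟩
  · rw [hkey]
    exact mul_nonneg hN.le (Finset.sum_nonneg hnn)
  · rw [h, sub_self, mul_zero] at hkey
    have hsum := (mul_eq_zero.mp hkey.symm).resolve_left hN.ne'
    -- Equality of integrals forces every nodal gap to vanish. Then `q` touches theta at all the
    -- nodes and must be its Hermite interpolant.
    rw [Finset.sum_eq_zero_iff_of_nonneg hnn] at hsum
    obtain ⟨c, hc⟩ := hq
    have hp : ∀ x : ℝ, (q (x : UnitAddCircle) : ℂ) =
        ∑ n ∈ Finset.Icc (-(N : ℤ)) N, c n * expChar n x := by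
      intro x
      simpa only [fourier_eq_expChar] using hc x
    have hT : 0 < lam⁻¹ := inv_pos.mpr hlam
    have hw : ∀ n, |thetaWeight lam⁻¹ n| ≤ thetaWeight lam⁻¹ n :=
      fun n => (abs_of_pos (Real.exp_pos _)).le
    have hI := hermiteInterp_eq_of_touching (a := a) (p := fun x : ℝ => q x) hp
      (differentiable_of_eq_sum_expChar hp) hε (hasDerivAt_cosSeries hT hw) hle
      (fun j hj => sub_eq_zero.mp ((mul_eq_zero.mp (hsum j hj)).resolve_left hε0))
    ext x
    induction x using QuotientAddGroup.induction_on with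
    | H x => exact (hI x).symm.trans (hm x).symm
  · rw [hq.integral_eq a, ← sum_theta_interpNode hlam, h]
    simp only [hmnode, f]

theorem theorem6 (lam : ℝ) (hlam : 0 < lam) (N : ℕ) :
    ((IsRealTrigPoly N (thetaMinorant lam N) ∧
        ∀ x : ℝ, thetaMinorant lam N (x : UnitAddCircle) ≤
          (theta3 x (Complex.I * (lam⁻¹ : ℝ))).re) ∧
      ∀ q : UnitAddCircle → ℝ, IsRealTrigPoly N q →
        (∀ x : ℝ, q (x : UnitAddCircle) ≤ (theta3 x (Complex.I * (lam⁻¹ : ℝ))).re) →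
        (∫ x : UnitAddCircle, q x) ≤
            (theta2 0 (Complex.I * (lam⁻¹ * ((N : ℝ) + 1) ^ 2 : ℝ))).re ∧
          ((∫ x : UnitAddCircle, q x) =
            (theta2 0 (Complex.I * (lam⁻¹ * ((N : ℝ) + 1) ^ 2 : ℝ))).re ↔
              q = thetaMinorant lam N)) ∧
    ((IsRealTrigPoly N (thetaMajorant lam N) ∧
        ∀ x : ℝ, (theta3 x (Complex.I * (lam⁻¹ : ℝ))).re ≤
          thetaMajorant lam N (x : UnitAddCircle)) ∧
      ∀ r : UnitAddCircle → ℝ, IsRealTrigPoly N r →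
        (∀ x : ℝ, (theta3 x (Complex.I * (lam⁻¹ : ℝ))).re ≤ r (x : UnitAddCircle)) →
        (theta3 0 (Complex.I * (lam⁻¹ * ((N : ℝ) + 1) ^ 2 : ℝ))).re ≤
            (∫ x : UnitAddCircle, r x) ∧
          ((theta3 0 (Complex.I * (lam⁻¹ * ((N : ℝ) + 1) ^ 2 : ℝ))).re =
            (∫ x : UnitAddCircle, r x) ↔
              r = thetaMajorant lam N)) := by

  have hT : 0 < lam⁻¹ := inv_pos.mpr hlam
  have hT' : 0 < lam⁻¹ * ((N : ℝ) + 1) ^ 2 := by positivity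
  have hr : ∀ i : ℕ, 0 ≤ Real.exp (-π * lam⁻¹) ^ (2 * i + 1) := fun i => by positivity
  have hcos : Real.cos (2 * π * (1 / 2)) = -1 := by
    rw [show 2 * π * (1 / 2) = π by ring, Real.cos_pi]
  have hdec : ∀ K, ∃ u S, Decomposes N (-1)
      (thetaProd (fun i => Real.exp (-π * lam⁻¹) ^ (2 * i + 1)) K) u S := fun K => by
    obtain ⟨u, S, h, -⟩ := exists_decomposes_thetaProd_neg_one N _ hr K
    exact ⟨u, S, h⟩
  -- The minorant uses half-integer offset, `a = 1/2` and `ε = -1`. The majorant below uses `a = 0`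
  -- and `ε = 1`.
  obtain ⟨l1, l2, l, hl⟩ := hermiteInterp_theta (N := N) hT (by norm_num) hcos hdec
  obtain ⟨m1, m2, m, hm⟩ := hermiteInterp_theta (N := N) (a := 0) (ε := 1) hT (by norm_num)
    (by simp) (exists_decomposes_thetaProd_one N _ hr)
  simp only [theta2_zero_eq_theta3, theta3_re_eq_cosSeries hT, theta3_re_eq_cosSeries hT']
  rw [show (theta3 0 (Complex.I * ((lam⁻¹ * ((N : ℝ) + 1) ^ 2 : ℝ) : ℂ))).re =
    cosSeries (thetaWeight (lam⁻¹ * ((N : ℝ) + 1) ^ 2)) 0 by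
      simpa using theta3_re_eq_cosSeries hT' 0]
  refine ⟨⟨⟨isRealTrigPoly_of_eq_cosPoly fun x => (thetaMinorant_coe hlam N x).trans (hl x),
    fun x => ?_⟩, fun q hq hle => ?_⟩,
    ⟨isRealTrigPoly_of_eq_cosPoly fun x => (thetaMajorant_coe hlam N x).trans (hm x),
    fun x => ?_⟩, fun q hq hle => ?_⟩
  · rw [thetaMinorant_coe hlam]
    linarith [l1 x]
  · obtain ⟨h1, h2⟩ := extremal_of_hermiteInterp hlam (ε := -1) (by norm_num)
      (thetaMinorant_coe hlam N) (fun j => (thetaMinorant_coe hlam N _).trans (l2 j)) hq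
      (fun x => by linarith [hle x])
    exact ⟨by linarith, h2⟩
  · rw [thetaMajorant_coe hlam]
    linarith [m1 x]
  · obtain ⟨h1, h2⟩ := extremal_of_hermiteInterp hlam (ε := 1) (by norm_num)
      (thetaMajorant_coe hlam N) (fun j => (thetaMajorant_coe hlam N _).trans (m2 j)) hq
      (fun x => by linarith [hle x])
    exact ⟨by linarith, eq_comm.trans h2⟩

end
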